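/- Three agents have values $v_1,v_2,v_3$ drawn independently from the uniform distribution on $[0,1]$ and compete for $k=2$ identical items through a queue. A clock $t$ shows the time remaining until the items are distributed; it starts at some $T_0\ge 1$ and descends to $0$. At the start each agent submits a sealed bid, the clock time at which he will attempt to join the queue; the bids may be revised only when a public message arrives, and then the agent may also attempt to join instantaneously. Arrivals are not observed by the other agents. An attempt succeeds if a place is left (simultaneous attempts are ordered uniformly at random, ties between the announcer and agents are in favour of the announcer), and each agent can attempt only once. An agent with value $v$ who joins at time $t$ gets utility $v-t$; an agent who does not join gets $0$. Let $\tau=2/9$, and let the information policy be the following: the announcer privately draws $\tau'\sim U([0,\tau])$ and at time $\tau'$ sends a message $m$ if the queue was empty at time $\tau$; otherwise she sends no message. Put $$b_I(v)=\frac{v(3-2v)}{3(2-v)},\qquad b_{YN}(v)=\frac{v(3\hat v-2v)}{3(2\hat v-v)},\qquad b_{NN}(v)=\frac{\sqrt{144v^4-216v^3+33v^2+72v+16}-12v^2+9v-4}{36(1-v)},\qquad \hat v=\tfrac12 .$$ Then the game has a symmetric perfect Bayesian equilibrium which is assortatively efficient, i.e. almost surely the two agents with the highest values get the items, and in which agents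 behave as follows. At the start, an agent with value $v\in[\tfrac12,1]$ bids $b_I(v)$ and an agent with value $v\in[0,\tfrac12)$ bids $b_{NN}(v)$ (so types $v\ge\hat v$ enter by time $\tau$ according to $b_I$, and after $\tau$, as long as no message has arrived, agents enter according to $b_{NN}$). If the message arrives at time $t\in(0,\tau]$ and $w\in[0,\tfrac12]$ is the type with $b_{NN}(w)=t$, then an agent with value $v$ who is still outside the queue bids $b_{YN}(\min\{v,w\})$; in particular, he bids $b_{YN}(v)$ if $v\le w$, which is always the case on the equilibrium path. The message is sent with positive probability, so non-trivial information policies can preserve assortative efficiency. -/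

import Mathlib

open MeasureTheory ProbabilityTheory

noncomputable section

namespace Queueing

/-! ### Histories, strategies, information policies -/

/-- What the announcer sees: public messages, and successful arrivals to the queue
(one `entry` per agent who gets a place), each with the clock time at which it happened.
The clock shows the time remaining, so it descends. -/
inductive Event (M : Type) where
  | message (m : M) (t : ℝ)
  | entry (t : ℝ)

/-- The public message history, in chronological order. -/
abbrev MsgHistory (M : Type) := List (M × ℝ)

/-- Lists are the disjoint union over `n` of the `n`-tuples; the σ-algebra is the one of that
disjoint union. -/
instance msgHistoryMeasurableSpace (M : Type) [MeasurableSpace M] :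
    MeasurableSpace (MsgHistory M) :=
  MeasurableSpace.comap (List.equivSigmaTuple (α := M × ℝ)) inferInstance

/-- The messages contained in a joint history. -/
def messages {M : Type} (h : List (Event M)) : MsgHistory M :=
  h.filterMap fun e => match e with
    | .message m t => some (m, t)
    | .entry _ => none

/-- The times of the successful arrivals contained in a joint history. -/
def entries {M : Type} (h : List (Event M)) : List ℝ :=
  h.filterMap fun e => match e with
    | .message _ _ => none
    | .entry t => some t

/-- A strategy maps the message history, the current clock time and the agent's value to a bid,
i.e. to the time at which the agent attempts to join the queue unless a new message arrives. -/
abbrev Strategy (M : Type) := MsgHistory M → ℝ → ℝ → ℝ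

/-- An information policy. The announcer's private randomness is a seed in `Θ` with law `seedLaw`,
drawn before the game. `draw θ T h` is the next message and its time, planned when the clock
shows `T` and the joint history is `h`; `none` means that no further message is planned. Only
finitely many messages may be sent. -/
structure InfoPolicy (M Θ : Type) [MeasurableSpace Θ] where
  seedLaw : Measure Θ
  draw : Θ → ℝ → List (Event M) → Option (M × ℝ)
  maxMessages : ℕ
  draw_eq_none : ∀ θ T h, maxMessages ≤ (messages h).length → draw θ T h = none

/-- The primitives of a queueing game with `n` agents: `k` items, values drawn independently from
`F`, which is supported on `[0, vmax]`, an information policy, and the clock time `startTime` at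
which the game begins. -/
structure QueueGame (n : ℕ) (M Θ : Type) [MeasurableSpace Θ] where
  k : ℕ
  F : Measure ℝ
  vmax : ℝ
  startTime : ℝ
  policy : InfoPolicy M Θ

/-! ### The play of the game -/

/-- `active`: the agent has not yet attempted to join. `attempted t q`: the agent attempted to
join at time `t` and the uniform tie-breaking gives the agent a place with probability `q`
(so `q = 1`: joined; `q = 0`: the queue was full). No second attempt is possible. -/
inductive Status where
  | active
  | attempted (t q : ℝ)

structure State (n : ℕ) (M : Type) where
  clock : ℝ
  hist : List (Event M)
  status : Fin n → Status

section Play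

variable {n : ℕ} {M Θ : Type} [MeasurableSpace Θ]

/-- The clock time of the latest message, or the starting time if there was none. -/
def lastUpdate (T₀ : ℝ) (h : MsgHistory M) : ℝ :=
  (h.getLast?.map Prod.snd).getD T₀

/-- The sealed bid of an agent. It is chosen at the start and revised only when a new message
arrives. A bid equal to the time of the latest message is an instantaneous attempt to join in
response to that message. -/
def sealedBid (G : QueueGame n M Θ) (s : Strategy M) (h : List (Event M)) (x : ℝ) : ℝ :=
  s (messages h) (lastUpdate G.startTime (messages h)) x

open Classical in
/-- The message the announcer will send next unless somebody attempts to join before. It has to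
lie strictly below the clock, except directly after an arrival to the queue, when
the announcer may also react instantaneously. A planned time `0` amounts to no message. -/
def nextMessage (G : QueueGame n M Θ) (θ : Θ) (S : State n M) : Option (M × ℝ) :=
  match G.policy.draw θ S.clock S.hist with
  | none => none
  | some (m, t) =>
      if 0 < t ∧ (t < S.clock ∨ (t = S.clock ∧ ∃ t', S.hist.getLast? = some (Event.entry t')))
      then some (m, t) else none

open Classical in
/-- The agents who have not yet attempted to join. -/
def activeAgents (S : State n M) : Finset (Fin n) :=
  Finset.univ.filter fun i => S.status i = Status.active

open Classical in
/-- At time `b` the agents in `E` attempt to join simultaneously. With `c` places left, each of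
them gets a place with probability `min 1 (c / |E|)`, and `min c |E|` of them enter. -/
def joinQueue (G : QueueGame n M Θ) (S : State n M) (b : ℝ) (E : Finset (Fin n)) : State n M :=
  let c : ℕ := G.k - (entries S.hist).length
  { clock := b
    hist := S.hist ++ List.replicate (min c E.card) (Event.entry b)
    status := fun i =>
      if i ∈ E then Status.attempted b (min 1 ((c : ℝ) / (E.card : ℝ))) else S.status i }

open Classical in
/-- One resolution step: either the highest bidders attempt to join, or the announcer's message is
released, whichever comes first on the descending clock; ties are in favour of the announcer. The
game is over when every agent has made an attempt. -/
def step (G : QueueGame n M Θ) (σ : Fin n → Strategy M) (v : Fin n → ℝ) (θ : Θ)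
    (S : State n M) : State n M :=
  if hA : (activeAgents S).Nonempty then
    let bid : Fin n → ℝ := fun i => sealedBid G (σ i) S.hist (v i)
    let b : ℝ := (activeAgents S).sup' hA bid
    let E : Finset (Fin n) := (activeAgents S).filter fun i => bid i = b
    match nextMessage G θ S with
    | none => joinQueue G S b E
    | some (m, t) =>
        if t < b then joinQueue G S b E
        else { clock := t, hist := S.hist ++ [Event.message m t], status := S.status }
  else S

/-- The final state for the strategy profile `σ`, values `v` and seed `θ`. Each step removes an
active agent or releases a message, so this number of steps exhausts the game. -/
def play (G : QueueGame n M Θ) (σ : Fin n → Strategy M) (v : Fin n → ℝ) (θ : Θ) : State n M :=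
  (step G σ v θ)^[n + G.policy.maxMessages]
    { clock := G.startTime, hist := [], status := fun _ => Status.active }

/-- All messages sent in the course of the play. -/
def publicMessages (G : QueueGame n M Θ) (σ : Fin n → Strategy M) (v : Fin n → ℝ) (θ : Θ) :
    MsgHistory M :=
  messages (play G σ v θ).hist

/-- The utility of agent `i` (expected over tie-breaking): value minus waiting time if the agent
gets a place, and `0` otherwise. -/
def utility (G : QueueGame n M Θ) (σ : Fin n → Strategy M) (v : Fin n → ℝ) (θ : Θ)
    (i : Fin n) : ℝ :=
  match (play G σ v θ).status i with
  | Status.active => 0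
  | Status.attempted t q => q * (v i - t)

/-- Agent `i` gets an item, however ties are broken. -/
def GetsItem (G : QueueGame n M Θ) (σ : Fin n → Strategy M) (v : Fin n → ℝ) (θ : Θ)
    (i : Fin n) : Prop :=
  ∃ t, (play G σ v θ).status i = Status.attempted t 1

/-- The joint law of the values and the announcer's seed. -/
def prior (G : QueueGame n M Θ) : Measure ((Fin n → ℝ) × Θ) :=
  (Measure.pi fun _ : Fin n => G.F).prod G.policy.seedLaw

end Play

/-! ### Equilibrium -/

section Equilibrium

variable {n : ℕ} {M Θ : Type} [MeasurableSpace M] [MeasurableSpace Θ]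

/-- A strategy is feasible if it is measurable, its initial bid lies in `[0, startTime)`, and
after a message at time `t` its bid lies in `[0, t]`, where `t` itself stands for an
instantaneous attempt to join. -/
def Feasible (G : QueueGame n M Θ) (s : Strategy M) : Prop :=
  Measurable (fun p : MsgHistory M × ℝ × ℝ => s p.1 p.2.1 p.2.2) ∧
  (∀ x ∈ Set.Icc 0 G.vmax, s [] G.startTime x ∈ Set.Ico 0 G.startTime) ∧
  (∀ (h : MsgHistory M) (m : M) (t : ℝ), 0 < t →
    ∀ x ∈ Set.Icc 0 G.vmax, s (h ++ [(m, t)]) t x ∈ Set.Icc 0 t)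

/-- The strategy that never bids more than `0`. -/
def abstain : Strategy M := fun _ _ _ => 0

open Classical in
/-- The strategy that stays out of the queue until the message history `h` has occurred and
follows `s` from then on. -/
def stayOutUntil (h : MsgHistory M) (s : Strategy M) : Strategy M :=
  fun h' t x => if h <+: h' then s h' t x else 0

/-- The messages that an agent `i` who is still outside the queue gets to see when
the others play `σ`. The announcer does not react to sealed bids, so what `i` bids does not matter
as long as `i` has not attempted to join. -/
def messagesSeenBy (G : QueueGame n M Θ) (σ : Fin n → Strategy M) (i : Fin n)
    (ω : (Fin n → ℝ) × Θ) : MsgHistory M :=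
  publicMessages G (Function.update σ i abstain) ω.1 ω.2

/-- A belief system: for every agent and message history the probabilities that this agent, if
not yet in the queue, assigns to the values and the announcer's seed. These determine the
beliefs about everything that has happened in the queue, in particular about the number of items
remaining. The agent's own value is known to the agent; the corresponding coordinate is
overwritten by it in `continuationValue`. -/
abbrev BeliefSystem (n : ℕ) (M Θ : Type) [MeasurableSpace M] [MeasurableSpace Θ] :=
  Fin n → Kernel (MsgHistory M) ((Fin n → ℝ) × Θ)

/-- Bayes' rule. For every number `j` of messages, `β i` is a regular conditional
distribution of the values and the seed, given the first `j` messages, on the event that at least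
`j` messages arrive while `i` is outside the queue. -/
def BayesConsistent (G : QueueGame n M Θ) (σ : Fin n → Strategy M)
    (β : BeliefSystem n M Θ) : Prop :=
  ∀ (i : Fin n) (j : ℕ) (B : Set (MsgHistory M)) (A : Set ((Fin n → ℝ) × Θ)),
    MeasurableSet B → MeasurableSet A →
    prior G ({ω | j ≤ (messagesSeenBy G σ i ω).length ∧ (messagesSeenBy G σ i ω).take j ∈ B} ∩ A) =
      ∫⁻ ω in {ω | j ≤ (messagesSeenBy G σ i ω).length ∧ (messagesSeenBy G σ i ω).take j ∈ B},
        β i ((messagesSeenBy G σ i ω).take j) A ∂(prior G)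

/-- At every single message history that can occur, beliefs are concentrated on the contingencies
in which it does occur. -/
def BeliefsFit (G : QueueGame n M Θ) (σ : Fin n → Strategy M) (β : BeliefSystem n M Θ) : Prop :=
  ∀ (i : Fin n) (h : MsgHistory M),
    (∃ ω : (Fin n → ℝ) × Θ, (∀ j, ω.1 j ∈ Set.Icc 0 G.vmax) ∧ h <+: messagesSeenBy G σ i ω) →
    ∀ᵐ ω ∂(β i h), h <+: messagesSeenBy G σ i ω

/-- The expected utility, under the beliefs at the message history `h`, of agent `i` with value
`x` who is then still outside the queue and from then on follows `s`, while the others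
play `σ`. -/
def continuationValue (G : QueueGame n M Θ) (σ : Fin n → Strategy M) (β : BeliefSystem n M Θ)
    (i : Fin n) (h : MsgHistory M) (x : ℝ) (s : Strategy M) : ℝ :=
  ∫ ω, utility G (Function.update σ i (stayOutUntil h s)) (Function.update ω.1 i x) ω.2 i ∂(β i h)

/-- Perfect Bayesian equilibrium: strategies are feasible, beliefs are probability measures that
follow Bayes' rule, and at every message history (on or off the path, in particular also when the
agent's own past behaviour deviated) and for every value, the prescribed strategy is a best
response to the others' strategies and to the beliefs. -/
structure IsPBE (G : QueueGame n M Θ) (σ : Fin n → Strategy M) (β : BeliefSystem n M Θ) :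
    Prop where
  feasible : ∀ i, Feasible G (σ i)
  prob : ∀ i h, IsProbabilityMeasure (β i h)
  bayes : BayesConsistent G σ β
  fit : BeliefsFit G σ β
  optimal : ∀ (i : Fin n) (h : MsgHistory M), ∀ x ∈ Set.Icc 0 G.vmax, ∀ d : Strategy M,
    Feasible G d →
      continuationValue G σ β i h x d ≤ continuationValue G σ β i h x (σ i)

open Classical in
/-- Assortative efficiency: almost surely, the `k` agents with the highest values get the items.
An agent is among these if fewer than `k` agents have a higher value. -/
def AssortativelyEfficient (G : QueueGame n M Θ) (σ : Fin n → Strategy M) : Prop :=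
  ∀ᵐ ω ∂(prior G), ∀ i : Fin n,
    (Finset.univ.filter fun j => ω.1 i < ω.1 j).card < G.k → GetsItem G σ ω.1 ω.2 i

end Equilibrium

/-! ### The continuous bad news policy -/

open Classical in
/-- The announcer privately draws a time `θ ∼ U([0, τ])` and at time `θ` sends the (only) message
if the queue was empty at time `τ`, i.e. if nobody has entered at a time `≥ τ`. -/
def contBadNewsPolicy (τ : ℝ) : InfoPolicy Unit ℝ where
  seedLaw := cond volume (Set.Icc 0 τ)
  draw θ _ h := if θ ≤ τ ∧ messages h = [] ∧ ∀ t ∈ entries h, t < τ then some ((), θ) else none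
  maxMessages := 1
  draw_eq_none := by
    intro θ T h hh
    refine if_neg ?_
    rintro ⟨-, h0, -⟩
    simp [h0] at hh

/-- Three agents, two items, values uniform on `[0, 1]`, and the policy above with `τ = 2/9`. -/
def contBadNewsGame (T₀ : ℝ) : QueueGame 3 Unit ℝ where
  k := 2
  F := cond volume (Set.Icc 0 1)
  vmax := 1
  startTime := T₀
  policy := contBadNewsPolicy (2 / 9)

/-- Bids before time `τ`. -/
def bI (v : ℝ) : ℝ := v * (3 - 2 * v) / (3 * (2 - v))

/-- Bids after the message. -/
def bYN (v : ℝ) : ℝ := v * (3 * (1 / 2) - 2 * v) / (3 * (2 * (1 / 2) - v))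

/-- Bids after time `τ` as long as there is no message. -/
def bNN (v : ℝ) : ℝ :=
  (Real.sqrt (144 * v ^ 4 - 216 * v ^ 3 + 33 * v ^ 2 + 72 * v + 16) - 12 * v ^ 2 + 9 * v - 4) /
    (36 * (1 - v))

end Queueing

end

noncomputable section

namespace Queueing

/-! ### The course of the play -/

section Histories

variable {M : Type}

/-! Against opponents who follow the candidate strategy, every bid is as good as, or worse than, the
bid of some type. An agent of value x therefore in effect chooses a type y to imitate, and each of
the three bid functions solves the first-order condition that makes y = x the best choice.

Entry by time 2/9: imitating y ≥ 1/2 fails only if both opponents lie above y. The gain is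
`earlyGain x y`, with y-derivative 2(1-y)(x-y). After a message: both opponents are known to be
below 1/2, and imitating z fails only if both lie in (z, 1/2). Up to the probability 1/4 of the
event, the gain is `postGain z x`, with z-derivative (1-2z)(x-z). If the message comes at time `bNN
w`, types above w are already in the queue and remaining bids do not exceed `bYN w`, so only z ≤ w
matters and the optimum is z = min x w. Waiting past 2/9 without a message: `waitGain x y` averages
over the announcer's time θ. If θ comes after the bid `bNN y`, the agent has already attempted; if
it comes before and both opponents are low, the message gain is obtained; otherwise the bid stands.
With Q the quadratic of `bNN_quadratic`, evaluated along `bNN`, the marginal gain of type y at its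
own bid is -(yQ)'/4 (`waitGain_foc`), so Q = 0 gives the first-order condition. At another type x
the marginal gain has the sign of x - y (`waitGain_le`). The two initial regimes agree at the type
1/2 (`bI_half`, `bNN_half`, `waitGain_half`), so comparisons across 2/9 pass through that type;
`integral_payoff_le_eqStrategy` combines them.

The time of the message is independent of the values, so the message reveals only that both
opponents are below 1/2. Bayes' rule then gives the conditional law `messageBelief`. Since `bYN` ≤
`bNN`, the bids after a message do not exceed its time. Since all bids increase in the value, a
lower type never gets ahead of a higher one, which gives efficiency.

The link with the dynamic game is made by invariants of the play (`BeforeMessage`, `AfterMessage`).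
They yield closed formulas for the outcome of one agent, `play_status_of_no_message` and
`play_status_of_message`, in the absence of ties involving that agent; relevant ties are null
events. -/

lemma messages_append (h h' : List (Event M)) :
    messages (h ++ h') = messages h ++ messages h' := by
  simp [messages, List.filterMap_append]

lemma entries_append (h h' : List (Event M)) :
    entries (h ++ h') = entries h ++ entries h' := by
  simp [entries, List.filterMap_append]

@[simp] lemma messages_replicate_entry (m : ℕ) (b : ℝ) :
    messages (List.replicate m (Event.entry b : Event M)) = [] := by
  simp [messages]

@[simp] lemma entries_replicate_entry (m : ℕ) (b : ℝ) :
    entries (List.replicate m (Event.entry b : Event M)) = List.replicate m b := by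
  induction m with
  | zero => rfl
  | succ m ih => simp [List.replicate_succ, entries]

@[simp] lemma messages_singleton_message (m : M) (t : ℝ) :
    messages [Event.message m t] = [(m, t)] := rfl

@[simp] lemma entries_singleton_message (m : M) (t : ℝ) :
    entries [Event.message m t] = [] := rfl

end Histories

/-! ### Single steps of a general queueing game -/

section Steps

variable {n : ℕ} {M Θ : Type} [MeasurableSpace Θ] {G : QueueGame n M Θ}
  {σ : Fin n → Strategy M} {v : Fin n → ℝ} {θ : Θ} {S : State n M}

lemma mem_activeAgents {i : Fin n} : i ∈ activeAgents S ↔ S.status i = Status.active := by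
  simp [activeAgents]

lemma messages_joinQueue (b : ℝ) (E : Finset (Fin n)) :
    messages (joinQueue G S b E).hist = messages S.hist := by
  simp [joinQueue, messages_append]

lemma entries_joinQueue (b : ℝ) (E : Finset (Fin n)) :
    entries (joinQueue G S b E).hist =
      entries S.hist ++ List.replicate (min (G.k - (entries S.hist).length) E.card) b := by
  simp [joinQueue, entries_append]

lemma mem_activeAgents_joinQueue {b : ℝ} {E : Finset (Fin n)} {i : Fin n} :
    i ∈ activeAgents (joinQueue G S b E) ↔ i ∈ activeAgents S ∧ i ∉ E := by
  by_cases hi : i ∈ E <;> simp [mem_activeAgents, joinQueue, hi]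

open Classical in
/-- The two kinds of step while some agent is active. -/
lemma step_cases (hA : (activeAgents S).Nonempty) :
    ∃ (b : ℝ) (E : Finset (Fin n)),
      (∀ j, j ∈ E ↔ j ∈ activeAgents S ∧ sealedBid G (σ j) S.hist (v j) = b) ∧ E.Nonempty ∧
      (∀ j ∈ activeAgents S, sealedBid G (σ j) S.hist (v j) ≤ b) ∧
      ((step G σ v θ S = joinQueue G S b E ∧
          ∀ m t, nextMessage G θ S = some (m, t) → t < b) ∨
        ∃ m t, nextMessage G θ S = some (m, t) ∧ b ≤ t ∧
          step G σ v θ S =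
            { clock := t, hist := S.hist ++ [Event.message m t], status := S.status }) := by
  set bid : Fin n → ℝ := fun j => sealedBid G (σ j) S.hist (v j) with hbid
  refine ⟨(activeAgents S).sup' hA bid,
    (activeAgents S).filter fun j => bid j = (activeAgents S).sup' hA bid, ?_, ?_, ?_, ?_⟩
  · intro j; simp [hbid]
  · obtain ⟨j, hj, hj'⟩ := Finset.exists_mem_eq_sup' hA bid
    exact ⟨j, by simp [hj, hj'.symm]⟩
  · intro j hj
    exact Finset.le_sup' bid hj
  · have hs : step G σ v θ S = match nextMessage G θ S with
      | none => joinQueue G S ((activeAgents S).sup' hA bid)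
          ((activeAgents S).filter fun j => bid j = (activeAgents S).sup' hA bid)
      | some (m, t) =>
        if t < (activeAgents S).sup' hA bid then
          joinQueue G S ((activeAgents S).sup' hA bid)
            ((activeAgents S).filter fun j => bid j = (activeAgents S).sup' hA bid)
        else { clock := t, hist := S.hist ++ [Event.message m t], status := S.status } := by
      unfold step
      exact (dif_pos hA).trans rfl
    rcases hm : nextMessage G θ S with _ | ⟨m, t⟩
    · left
      rw [hm] at hs
      exact ⟨hs, by simp⟩
    · rw [hm] at hs
      by_cases ht : t < (activeAgents S).sup' hA bid
      · left
        refine ⟨by simpa [ht] using hs, ?_⟩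
        intro m' t' h
        simp only [Option.some.injEq, Prod.mk.injEq] at h
        exact h.2 ▸ ht
      · right
        exact ⟨m, t, rfl, not_lt.mp ht, by simpa [ht] using hs⟩

lemma step_of_no_active (hA : ¬ (activeAgents S).Nonempty) : step G σ v θ S = S := by
  rw [step, dif_neg hA]

/-- An attempt is final. -/
lemma step_status_of_not_active {i : Fin n} (hi : i ∉ activeAgents S) :
    (step G σ v θ S).status i = S.status i := by
  by_cases hA : (activeAgents S).Nonempty
  · obtain ⟨b, E, hE, -, -, ⟨h, -⟩ | ⟨m, t, -, -, h⟩⟩ :=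
      step_cases (G := G) (σ := σ) (v := v) (θ := θ) hA
    · have hiE : i ∉ E := fun h' => hi ((hE i).1 h').1
      rw [h]; simp [joinQueue, hiE]
    · rw [h]
  · rw [step_of_no_active hA]

end Steps

/-! ### Invariants of the play under the bad news policy -/

section BadNews

variable {T₀ : ℝ} {σ : Fin 3 → Strategy Unit} {v : Fin 3 → ℝ} {θ : ℝ} {S : State 3 Unit}

lemma nextMessage_eq_some {t : ℝ} {m : Unit}
    (h : nextMessage (contBadNewsGame T₀) θ S = some (m, t)) :
    t = θ ∧ messages S.hist = [] ∧ 0 < θ ∧ θ ≤ 2 / 9 ∧ ∀ u ∈ entries S.hist, u < 2 / 9 := by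
  simp only [nextMessage, contBadNewsGame, contBadNewsPolicy] at h
  by_cases hc : θ ≤ 2 / 9 ∧ messages S.hist = [] ∧ ∀ u ∈ entries S.hist, u < 2 / 9
  · rw [if_pos hc] at h
    simp only at h
    split_ifs at h with h'
    simp only [Option.some.injEq, Prod.mk.injEq] at h
    exact ⟨h.2.symm, hc.2.1, h'.1, hc.1, hc.2.2⟩
  · rw [if_neg hc] at h
    simp at h

lemma nextMessage_of_alive (h0 : 0 < θ) (h1 : θ ≤ 2 / 9) (hm : messages S.hist = [])
    (he : ∀ u ∈ entries S.hist, u < 2 / 9) (hc : θ < S.clock) :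
    nextMessage (contBadNewsGame T₀) θ S = some ((), θ) := by
  simp only [nextMessage, contBadNewsGame, contBadNewsPolicy]
  rw [if_pos ⟨h1, hm, he⟩]
  simp [h0, hc]

/-- The state while no message has been sent, when the initial bids are `a`. -/
structure BeforeMessage (a : Fin 3 → ℝ) (θ : ℝ) (S : State 3 Unit) : Prop where
  msgs : messages S.hist = []
  len : (entries S.hist).length = min 2 (activeAgents S)ᶜ.card
  late : ∀ t ∈ entries S.hist, ∃ j, j ∉ activeAgents S ∧ t = a j
  early : ∀ j, j ∉ activeAgents S → ∃ t ∈ entries S.hist, a j ≤ t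
  clock : (∀ t ∈ entries S.hist, t < 2 / 9) → 0 < θ → θ ≤ 2 / 9 →
    θ < S.clock ∧ ∀ j, j ∉ activeAgents S → θ < a j
  order : ∀ i ∈ activeAgents S, ∀ j, j ∉ activeAgents S → a i < a j

/-- The state after the message, when the initial bids are `a` and the later ones are `c`. -/
structure AfterMessage (a c : Fin 3 → ℝ) (θ : ℝ) (S : State 3 Unit) : Prop where
  msgs : messages S.hist = [((), θ)]
  len : (entries S.hist).length = min 2 (activeAgents S)ᶜ.card
  low : ∀ j ∈ activeAgents S, a j ≤ θ
  order : ∀ i ∈ activeAgents S, ∀ j, j ∉ activeAgents S → θ < a j ∨ c i < c j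

lemma compl_card_joinQueue {G : QueueGame 3 Unit ℝ} {b : ℝ} {E : Finset (Fin 3)}
    (hE : E ⊆ activeAgents S) :
    (activeAgents (joinQueue G S b E))ᶜ.card = (activeAgents S)ᶜ.card + E.card := by
  classical
  have : (activeAgents (joinQueue G S b E))ᶜ = (activeAgents S)ᶜ ∪ E := by
    ext j
    simp only [Finset.mem_compl, mem_activeAgents_joinQueue, Finset.mem_union]
    tauto
  rw [this, Finset.card_union_of_disjoint]
  exact Finset.disjoint_left.2 fun j hj hj' => (Finset.mem_compl.1 hj) (hE hj')

lemma length_entries_joinQueue {b : ℝ} {E : Finset (Fin 3)} (hE : E ⊆ activeAgents S)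
    (hlen : (entries S.hist).length = min 2 (activeAgents S)ᶜ.card) :
    (entries (joinQueue (contBadNewsGame T₀) S b E).hist).length =
      min 2 (activeAgents (joinQueue (contBadNewsGame T₀) S b E))ᶜ.card := by
  have hk : (contBadNewsGame T₀).k = 2 := rfl
  rw [entries_joinQueue, compl_card_joinQueue hE, List.length_append, List.length_replicate, hlen,
    hk]
  omega

lemma card_activeAgents_joinQueue {G : QueueGame 3 Unit ℝ} {b : ℝ} {E : Finset (Fin 3)}
    (hE : E ⊆ activeAgents S) (hne : E.Nonempty) :
    (activeAgents (joinQueue G S b E)).card < (activeAgents S).card := by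
  have h := compl_card_joinQueue (G := G) (b := b) hE
  have h1 := Finset.card_compl_add_card (activeAgents S)
  have h2 := Finset.card_compl_add_card (activeAgents (joinQueue G S b E))
  have := hne.card_pos
  omega

open Classical in
/-- An agent who attempts alone gets a place unless both other agents are ahead. -/
lemma joinQueue_status_of_alone {i : Fin 3} {b : ℝ} {E : Finset (Fin 3)} {P : Fin 3 → Prop}
    (hE : ∀ j, j ∈ E ↔ j = i) (hi : i ∈ activeAgents S)
    (hlen : (entries S.hist).length = min 2 (activeAgents S)ᶜ.card)
    (hP : ∀ j ≠ i, (j ∉ activeAgents S ↔ P j)) :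
    (joinQueue (contBadNewsGame T₀) S b E).status i =
      Status.attempted b (if ∀ j ≠ i, P j then 0 else 1) := by
  have hE' : E = {i} := by ext j; simp [hE]
  have hk : (contBadNewsGame T₀).k = 2 := rfl
  have hsub : (activeAgents S)ᶜ ⊆ {i}ᶜ := by
    intro j hj
    simp only [Finset.mem_compl, Finset.mem_singleton] at hj ⊢
    rintro rfl; exact hj hi
  have hcard : ({i}ᶜ : Finset (Fin 3)).card = 2 := by
    simp [Finset.card_compl]
  have hle := Finset.card_le_card hsub
  subst hE'
  simp only [joinQueue, Finset.mem_singleton, if_true, Finset.card_singleton, hk, hlen]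
  congr 1
  split_ifs with h
  · have : (activeAgents S)ᶜ = {i}ᶜ := by
      refine Finset.Subset.antisymm hsub ?_
      intro j hj
      simp only [Finset.mem_compl, Finset.mem_singleton] at hj ⊢
      exact (hP j hj).2 (h j hj)
    rw [this, hcard]; norm_num
  · have : (activeAgents S)ᶜ.card < 2 := by
      by_contra hlt
      have heq := Finset.eq_of_subset_of_card_le hsub (by omega)
      refine h fun j hj => (hP j hj).1 ?_
      have : j ∈ (activeAgents S)ᶜ := by rw [heq]; simpa using hj
      simpa using this
    -- The number of places left is a truncated subtraction, so the bound is proved in ℕ and then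
    -- cast.
    have h2 : (1 : ℝ) ≤ ((2 - min 2 (activeAgents S)ᶜ.card : ℕ) : ℝ) := by
      exact_mod_cast (by omega : 1 ≤ 2 - min 2 (activeAgents S)ᶜ.card)
    rw [min_eq_left]
    simpa using h2

lemma BeforeMessage.sealedBid {a : Fin 3 → ℝ} (h : BeforeMessage a θ S) (s : Strategy Unit)
    (x : ℝ) : sealedBid (contBadNewsGame T₀) s S.hist x = s [] T₀ x := by
  simp [Queueing.sealedBid, h.msgs, lastUpdate, contBadNewsGame]

lemma AfterMessage.sealedBid {a c : Fin 3 → ℝ} (h : AfterMessage a c θ S) (s : Strategy Unit)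
    (x : ℝ) : sealedBid (contBadNewsGame T₀) s S.hist x = s [((), θ)] θ x := by
  simp [Queueing.sealedBid, h.msgs, lastUpdate]

lemma BeforeMessage.initial (a : Fin 3 → ℝ) (hT₀ : 1 ≤ T₀) :
    BeforeMessage a θ { clock := T₀, hist := [], status := fun _ => Status.active } := by
  have hact : ∀ j, j ∈ activeAgents
      ({ clock := T₀, hist := [], status := fun _ => Status.active } : State 3 Unit) :=
    fun j => by simp [mem_activeAgents]
  refine ⟨rfl, ?_, by simp [entries], fun j hj => (hj (hact j)).elim, ?_,
    fun _ _ j hj => (hj (hact j)).elim⟩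
  · have : activeAgents
      ({ clock := T₀, hist := [], status := fun _ => Status.active } : State 3 Unit) =
        Finset.univ := by ext j; simp [hact]
    simp [this, entries]
  · intro _ _ h
    exact ⟨by simp only; linarith, fun j hj => (hj (hact j)).elim⟩

/-- The highest active bidders leave, so bids of leavers strictly exceed those of stayers. If the
message is still due, a join can come first only at a time strictly above θ, because ties favour the
announcer; this keeps the `clock` field true. -/
lemma BeforeMessage.join {a : Fin 3 → ℝ} (h : BeforeMessage a θ S) {b : ℝ}
    {E : Finset (Fin 3)} (hE : ∀ j, j ∈ E ↔ j ∈ activeAgents S ∧ a j = b) (hne : E.Nonempty)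
    (hb : ∀ j ∈ activeAgents S, a j ≤ b)
    (hm : ∀ m t, nextMessage (contBadNewsGame T₀) θ S = some (m, t) → t < b) :
    BeforeMessage a θ (joinQueue (contBadNewsGame T₀) S b E) := by
  have hk : (contBadNewsGame T₀).k = 2 := rfl
  have hsub : E ⊆ activeAgents S := fun j hj => ((hE j).1 hj).1
  obtain ⟨e, he⟩ := hne
  have hea := (hE e).1 he
  have hnot : ∀ j, j ∉ activeAgents (joinQueue (contBadNewsGame T₀) S b E) ↔
      j ∉ activeAgents S ∨ j ∈ E := by
    intro j; rw [mem_activeAgents_joinQueue]; tauto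
  refine ⟨by rw [messages_joinQueue, h.msgs], length_entries_joinQueue hsub h.len, ?_, ?_, ?_, ?_⟩
  · intro t ht
    rw [entries_joinQueue, List.mem_append] at ht
    rcases ht with ht | ht
    · obtain ⟨j, hj, rfl⟩ := h.late t ht
      exact ⟨j, (hnot j).2 (Or.inl hj), rfl⟩
    · exact ⟨e, (hnot e).2 (Or.inr he), by rw [hea.2]; exact List.eq_of_mem_replicate ht⟩
  · intro j hj
    rw [entries_joinQueue, hk]
    rcases (hnot j).1 hj with hj | hj
    · obtain ⟨t, ht, hjt⟩ := h.early j hj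
      exact ⟨t, List.mem_append_left _ ht, hjt⟩
    · have hj' := (hE j).1 hj
      by_cases h2 : (entries S.hist).length < 2
      · refine ⟨b, List.mem_append_right _ ?_, hj'.2.le⟩
        have : 0 < E.card := Finset.card_pos.2 ⟨e, he⟩
        refine List.mem_replicate.2 ⟨?_, rfl⟩
        omega
      -- The queue is already full and the attempt leaves no entry of its own. An earlier entry,
      -- made at a higher bid, serves as the witness.
      · obtain ⟨t, ht⟩ := List.exists_mem_of_length_pos (l := entries S.hist) (by omega)
        obtain ⟨l, hl, rfl⟩ := h.late t ht
        exact ⟨a l, List.mem_append_left _ ht, (h.order j hj'.1 l hl).le⟩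
  · intro hlow h0 h1
    have hlow' : ∀ t ∈ entries S.hist, t < 2 / 9 := by
      intro t ht
      refine hlow t ?_
      rw [entries_joinQueue]
      exact List.mem_append_left _ ht
    obtain ⟨hc, ha⟩ := h.clock hlow' h0 h1
    -- Nobody has entered by 2/9, so the message at θ is still planned, and the join must precede
    -- it.
    have hlt := hm _ _ (nextMessage_of_alive h0 h1 h.msgs hlow' hc)
    refine ⟨hlt, fun j hj => ?_⟩
    rcases (hnot j).1 hj with hj | hj
    · exact ha j hj
    · rw [((hE j).1 hj).2]; exact hlt
  · intro i hi j hj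
    rw [mem_activeAgents_joinQueue] at hi
    rcases (hnot j).1 hj with hj | hj
    · exact h.order i hi.1 j hj
    · rw [((hE j).1 hj).2]
      exact lt_of_le_of_ne (hb i hi.1) fun hi' => hi.2 ((hE i).2 ⟨hi.1, hi'⟩)

lemma AfterMessage.join {a c : Fin 3 → ℝ} (h : AfterMessage a c θ S) {b : ℝ}
    {E : Finset (Fin 3)} (hE : ∀ j, j ∈ E ↔ j ∈ activeAgents S ∧ c j = b)
    (hb : ∀ j ∈ activeAgents S, c j ≤ b) :
    AfterMessage a c θ (joinQueue (contBadNewsGame T₀) S b E) := by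
  have hsub : E ⊆ activeAgents S := fun j hj => ((hE j).1 hj).1
  have hnot : ∀ j, j ∉ activeAgents (joinQueue (contBadNewsGame T₀) S b E) ↔
      j ∉ activeAgents S ∨ j ∈ E := by
    intro j; rw [mem_activeAgents_joinQueue]; tauto
  refine ⟨by rw [messages_joinQueue, h.msgs], length_entries_joinQueue hsub h.len, ?_, ?_⟩
  · intro j hj
    exact h.low j (mem_activeAgents_joinQueue.1 hj).1
  · intro i hi j hj
    rw [mem_activeAgents_joinQueue] at hi
    rcases (hnot j).1 hj with hj | hj
    · exact h.order i hi.1 j hj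
    · right
      rw [((hE j).1 hj).2]
      exact lt_of_le_of_ne (hb i hi.1) fun hi' => hi.2 ((hE i).2 ⟨hi.1, hi'⟩)

/-- Whoever has joined did so strictly before the clock reached θ, and whoever is still active has
an initial bid of at most θ. This is the dichotomy recorded in the `order` field. -/
lemma BeforeMessage.send {a c : Fin 3 → ℝ} (h : BeforeMessage a θ S) {b : ℝ} {m : Unit} {t : ℝ}
    (hb : ∀ j ∈ activeAgents S, a j ≤ b)
    (hm : nextMessage (contBadNewsGame T₀) θ S = some (m, t)) (hbt : b ≤ t) :
    AfterMessage a c θ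
      { clock := t, hist := S.hist ++ [Event.message m t], status := S.status } := by
  obtain ⟨rfl, -, h0, h1, he⟩ := nextMessage_eq_some hm
  refine ⟨by simp [messages_append, h.msgs], ?_, fun j hj => (hb j hj).trans hbt,
    fun i _ j hj => Or.inl ((h.clock he h0 h1).2 j hj)⟩
  simp only [entries_append, entries_singleton_message, List.append_nil]
  exact h.len

/-- If a message is sent then nobody entered by time `2 / 9`. -/
lemma BeforeMessage.send_low {a : Fin 3 → ℝ} (h : BeforeMessage a θ S) {b : ℝ} {m : Unit} {t : ℝ}
    (hb : ∀ j ∈ activeAgents S, a j ≤ b)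
    (hm : nextMessage (contBadNewsGame T₀) θ S = some (m, t)) (hbt : b ≤ t) (j : Fin 3) :
    a j < 2 / 9 ∨ a j ≤ θ := by
  obtain ⟨rfl, -, h0, h1, he⟩ := nextMessage_eq_some hm
  by_cases hj : j ∈ activeAgents S
  · exact Or.inr ((hb j hj).trans hbt)
  · obtain ⟨u, hu, hju⟩ := h.early j hj
    exact Or.inl (hju.trans_lt (he u hu))

/-! ### The invariants along the whole play -/

/-- The state after `m` steps. -/
def stateAfter (T₀ : ℝ) (σ : Fin 3 → Strategy Unit) (v : Fin 3 → ℝ) (θ : ℝ) (m : ℕ) :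
    State 3 Unit :=
  (step (contBadNewsGame T₀) σ v θ)^[m]
    { clock := T₀, hist := [], status := fun _ => Status.active }

lemma stateAfter_succ (m : ℕ) : stateAfter T₀ σ v θ (m + 1) =
    step (contBadNewsGame T₀) σ v θ (stateAfter T₀ σ v θ m) := by
  rw [stateAfter, Function.iterate_succ_apply', stateAfter]

/-- Three agents and at most one message give four steps. -/
lemma play_eq_stateAfter :
    play (contBadNewsGame T₀) σ v θ = stateAfter T₀ σ v θ 4 := rfl

/-- After the message nothing is announced any more. -/
lemma step_of_messages_ne_nil (hm : messages S.hist ≠ []) :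
    messages (step (contBadNewsGame T₀) σ v θ S).hist = messages S.hist := by
  by_cases hA : (activeAgents S).Nonempty
  · obtain ⟨b, E, -, -, -, ⟨h, -⟩ | ⟨m, t, h', -, -⟩⟩ :=
      step_cases (G := contBadNewsGame T₀) (σ := σ) (v := v) (θ := θ) hA
    · rw [h, messages_joinQueue]
    · exact (hm (nextMessage_eq_some h').2.1).elim
  · rw [step_of_no_active hA]

lemma messages_stateAfter (hT₀ : 1 ≤ T₀) (m : ℕ) :
    (BeforeMessage (fun j => σ j [] T₀ (v j)) θ (stateAfter T₀ σ v θ m)) ∨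
      (messages (stateAfter T₀ σ v θ m).hist = [((), θ)] ∧ 0 < θ ∧ θ ≤ 2 / 9 ∧
        ∀ j, σ j [] T₀ (v j) < 2 / 9 ∨ σ j [] T₀ (v j) ≤ θ) := by
  induction m with
  | zero => exact Or.inl (BeforeMessage.initial _ hT₀)
  | succ m ih =>
    rw [stateAfter_succ]
    generalize stateAfter T₀ σ v θ m = S at ih
    rcases ih with h | ⟨h, h'⟩
    · by_cases hA : (activeAgents S).Nonempty
      · obtain ⟨b, E, hE, hne, hb, ⟨hs, hm⟩ | ⟨m', t, hm, hbt, hs⟩⟩ :=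
          step_cases (G := contBadNewsGame T₀) (σ := σ) (v := v) (θ := θ) hA
        · simp only [h.sealedBid] at hE hb
          rw [hs]
          exact Or.inl (h.join hE hne hb hm)
        · simp only [h.sealedBid] at hE hb
          rw [hs]
          have hm' := nextMessage_eq_some hm
          exact Or.inr ⟨(h.send (c := 0) hb hm hbt).msgs, hm'.2.2.1, hm'.2.2.2.1,
            h.send_low hb hm hbt⟩
      · rw [step_of_no_active hA]; exact Or.inl h
    · right
      refine ⟨?_, h'⟩
      rw [step_of_messages_ne_nil (by rw [h]; simp), h]

/-- At most one message is sent, at the time drawn by the announcer. -/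
lemma publicMessages_cases (hT₀ : 1 ≤ T₀) :
    publicMessages (contBadNewsGame T₀) σ v θ = [] ∨
      (publicMessages (contBadNewsGame T₀) σ v θ = [((), θ)] ∧ 0 < θ ∧ θ ≤ 2 / 9 ∧
        ∀ j, σ j [] T₀ (v j) < 2 / 9 ∨ σ j [] T₀ (v j) ≤ θ) := by
  rw [publicMessages, play_eq_stateAfter]
  rcases messages_stateAfter (σ := σ) (v := v) (θ := θ) hT₀ 4 with h | h
  · exact Or.inl h.msgs
  · exact Or.inr h

/-- The message is sent if nobody entered by time `2 / 9` and somebody is still outside. -/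
lemma publicMessages_eq (hT₀ : 1 ≤ T₀) (h0 : 0 < θ) (h1 : θ ≤ 2 / 9) (i : Fin 3)
    (hj : ∀ j ≠ i, σ j [] T₀ (v j) < 2 / 9) (hi : σ i [] T₀ (v i) ≤ θ) :
    publicMessages (contBadNewsGame T₀) σ v θ = [((), θ)] := by
  -- Every join removes an active agent, so the count card + m ≤ 3 persists while no message is
  -- sent. At m = 4 it is absurd, which leaves the first alternative.
  have key : ∀ m, messages (stateAfter T₀ σ v θ m).hist = [((), θ)] ∨
      (BeforeMessage (fun j => σ j [] T₀ (v j)) θ (stateAfter T₀ σ v θ m) ∧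
        i ∈ activeAgents (stateAfter T₀ σ v θ m) ∧
        (activeAgents (stateAfter T₀ σ v θ m)).card + m ≤ 3) := by
    intro m
    induction m with
    | zero =>
      exact Or.inr ⟨BeforeMessage.initial _ hT₀, by simp [stateAfter, mem_activeAgents],
        by simpa using Finset.card_le_univ (activeAgents (stateAfter T₀ σ v θ 0))⟩
    | succ m ih =>
      rw [stateAfter_succ]
      generalize stateAfter T₀ σ v θ m = S at ih
      rcases ih with h | ⟨h, hiS, hcard⟩
      · left
        rw [step_of_messages_ne_nil (by rw [h]; simp), h]
      · obtain ⟨b, E, hE, hne, hb, ⟨hs, hm⟩ | ⟨m', t, hm, hbt, hs⟩⟩ :=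
          step_cases (G := contBadNewsGame T₀) (σ := σ) (v := v) (θ := θ) ⟨i, hiS⟩
        · simp only [h.sealedBid] at hE hb
          right
          rw [hs]
          have hsub : E ⊆ activeAgents S := fun j hj => ((hE j).1 hj).1
          have hlow : ∀ t ∈ entries S.hist, t < 2 / 9 := by
            intro t ht
            obtain ⟨j, hj', rfl⟩ := h.late t ht
            exact hj j (by rintro rfl; exact hj' hiS)
          have hlt := hm _ _ (nextMessage_of_alive h0 h1 h.msgs hlow (h.clock hlow h0 h1).1)
          refine ⟨h.join hE hne hb hm, mem_activeAgents_joinQueue.2 ⟨hiS, fun hiE => ?_⟩, ?_⟩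
          · have := ((hE i).1 hiE).2
            linarith
          · have := card_activeAgents_joinQueue (G := contBadNewsGame T₀) (b := b) hsub hne
            omega
        · simp only [h.sealedBid] at hE hb
          left
          rw [hs]
          exact (h.send (c := 0) hb hm hbt).msgs
  rw [publicMessages, play_eq_stateAfter]
  rcases key 4 with h | ⟨-, -, h⟩
  · exact h
  · omega

open Classical in
/-- The outcome for an agent who attempts to join at his initial bid. -/
lemma play_status_of_no_message (hT₀ : 1 ≤ T₀) (i : Fin 3)
    (hN : 0 < θ → θ ≤ 2 / 9 → (∀ j ≠ i, σ j [] T₀ (v j) < 2 / 9 ∨ σ j [] T₀ (v j) ≤ θ) →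
      θ < σ i [] T₀ (v i))
    (htie : ∀ j ≠ i, σ j [] T₀ (v j) ≠ σ i [] T₀ (v i)) :
    (play (contBadNewsGame T₀) σ v θ).status i = Status.attempted (σ i [] T₀ (v i))
      (if ∀ j ≠ i, σ i [] T₀ (v i) < σ j [] T₀ (v j) then 0 else 1) := by
  set a : Fin 3 → ℝ := fun j => σ j [] T₀ (v j) with ha
  have key : ∀ m, (stateAfter T₀ σ v θ m).status i =
      Status.attempted (a i) (if ∀ j ≠ i, a i < a j then 0 else 1) ∨
      (BeforeMessage a θ (stateAfter T₀ σ v θ m) ∧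
        i ∈ activeAgents (stateAfter T₀ σ v θ m) ∧
        (activeAgents (stateAfter T₀ σ v θ m)).card + m ≤ 3) := by
    intro m
    induction m with
    | zero =>
      exact Or.inr ⟨BeforeMessage.initial _ hT₀, by simp [stateAfter, mem_activeAgents],
        by simpa using Finset.card_le_univ (activeAgents (stateAfter T₀ σ v θ 0))⟩
    | succ m ih =>
      rw [stateAfter_succ]
      generalize stateAfter T₀ σ v θ m = S at ih
      rcases ih with h | ⟨h, hiS, hcard⟩
      · left
        rw [step_status_of_not_active (by rw [mem_activeAgents, h]; simp), h]
      · obtain ⟨b, E, hE, hne, hb, ⟨hs, hm⟩ | ⟨m', t, hm, hbt, hs⟩⟩ :=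
          step_cases (G := contBadNewsGame T₀) (σ := σ) (v := v) (θ := θ) ⟨i, hiS⟩
        · simp only [h.sealedBid] at hE hb
          rw [hs]
          have hsub : E ⊆ activeAgents S := fun j hj => ((hE j).1 hj).1
          by_cases hiE : i ∈ E
          · left
            have hbi : a i = b := ((hE i).1 hiE).2
            have hE' : ∀ j, j ∈ E ↔ j = i := by
              intro j
              refine ⟨fun hj => ?_, by rintro rfl; exact hiE⟩
              by_contra hne'
              exact htie j hne' (((hE j).1 hj).2.trans hbi.symm)
            rw [joinQueue_status_of_alone (P := fun j => a i < a j) hE' hiS h.len, hbi]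
            intro j _
            refine ⟨fun hj => h.order i hiS j hj, fun hj hj' => ?_⟩
            have := hb j hj'
            exact absurd hj (not_lt.2 (hbi ▸ this))
          · right
            refine ⟨h.join hE hne hb hm, mem_activeAgents_joinQueue.2 ⟨hiS, hiE⟩, ?_⟩
            have := card_activeAgents_joinQueue (G := contBadNewsGame T₀) (b := b) hsub hne
            omega
        · simp only [h.sealedBid] at hE hb
          exfalso
          obtain ⟨rfl, -, h0, h1, -⟩ := nextMessage_eq_some hm
          have := hN h0 h1 fun j _ => h.send_low hb hm hbt j
          have := hb i hiS
          linarith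
  rw [play_eq_stateAfter]
  rcases key 4 with h | ⟨-, -, h⟩
  · exact h
  · omega

open Classical in
/-- The outcome for an agent who is outside when the message arrives. -/
lemma play_status_of_message (hT₀ : 1 ≤ T₀) (i : Fin 3) (h0 : 0 < θ) (h1 : θ ≤ 2 / 9)
    (hj : ∀ j ≠ i, σ j [] T₀ (v j) < 2 / 9) (hi : σ i [] T₀ (v i) ≤ θ)
    (htie : ∀ j ≠ i, θ < σ j [] T₀ (v j) ∨ σ j [((), θ)] θ (v j) ≠ σ i [((), θ)] θ (v i)) :
    (play (contBadNewsGame T₀) σ v θ).status i = Status.attempted (σ i [((), θ)] θ (v i))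
      (if ∀ j ≠ i, θ < σ j [] T₀ (v j) ∨ σ i [((), θ)] θ (v i) < σ j [((), θ)] θ (v j)
        then 0 else 1) := by
  set a : Fin 3 → ℝ := fun j => σ j [] T₀ (v j) with ha
  set c : Fin 3 → ℝ := fun j => σ j [((), θ)] θ (v j) with hc
  -- The message uses up one step without removing an agent, hence the bound 4 instead of 3 in the
  -- last alternative. At m = 4 it contradicts that i is still active.
  have key : ∀ m, (stateAfter T₀ σ v θ m).status i =
      Status.attempted (c i) (if ∀ j ≠ i, θ < a j ∨ c i < c j then 0 else 1) ∨
      (BeforeMessage a θ (stateAfter T₀ σ v θ m) ∧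
        i ∈ activeAgents (stateAfter T₀ σ v θ m) ∧
        (activeAgents (stateAfter T₀ σ v θ m)).card + m ≤ 3) ∨
      (AfterMessage a c θ (stateAfter T₀ σ v θ m) ∧
        i ∈ activeAgents (stateAfter T₀ σ v θ m) ∧
        (activeAgents (stateAfter T₀ σ v θ m)).card + m ≤ 4) := by
    intro m
    induction m with
    | zero =>
      exact Or.inr (Or.inl ⟨BeforeMessage.initial _ hT₀, by simp [stateAfter, mem_activeAgents],
        by simpa using Finset.card_le_univ (activeAgents (stateAfter T₀ σ v θ 0))⟩)
    | succ m ih =>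
      rw [stateAfter_succ]
      generalize stateAfter T₀ σ v θ m = S at ih
      rcases ih with h | ⟨h, hiS, hcard⟩ | ⟨h, hiS, hcard⟩
      · left
        rw [step_status_of_not_active (by rw [mem_activeAgents, h]; simp), h]
      · obtain ⟨b, E, hE, hne, hb, ⟨hs, hm⟩ | ⟨m', t, hm, hbt, hs⟩⟩ :=
          step_cases (G := contBadNewsGame T₀) (σ := σ) (v := v) (θ := θ) ⟨i, hiS⟩
        · simp only [h.sealedBid] at hE hb
          right; left
          rw [hs]
          have hsub : E ⊆ activeAgents S := fun j hj => ((hE j).1 hj).1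
          have hlow : ∀ t ∈ entries S.hist, t < 2 / 9 := by
            intro t ht
            obtain ⟨j, hj', rfl⟩ := h.late t ht
            exact hj j (by rintro rfl; exact hj' hiS)
          have hlt := hm _ _ (nextMessage_of_alive h0 h1 h.msgs hlow (h.clock hlow h0 h1).1)
          refine ⟨h.join hE hne hb hm, mem_activeAgents_joinQueue.2 ⟨hiS, fun hiE => ?_⟩, ?_⟩
          · have : a i = b := ((hE i).1 hiE).2
            have : a i ≤ θ := hi
            linarith
          · have := card_activeAgents_joinQueue (G := contBadNewsGame T₀) (b := b) hsub hne
            omega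
        · simp only [h.sealedBid] at hE hb
          right; right
          rw [hs]
          refine ⟨h.send hb hm hbt, hiS, ?_⟩
          change (activeAgents S).card + (m + 1) ≤ 4
          omega
      · obtain ⟨b, E, hE, hne, hb, ⟨hs, hm⟩ | ⟨m', t, hm, hbt, hs⟩⟩ :=
          step_cases (G := contBadNewsGame T₀) (σ := σ) (v := v) (θ := θ) ⟨i, hiS⟩
        · simp only [h.sealedBid] at hE hb
          rw [hs]
          have hsub : E ⊆ activeAgents S := fun j hj => ((hE j).1 hj).1
          by_cases hiE : i ∈ E
          · left
            have hbi : c i = b := ((hE i).1 hiE).2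
            have hE' : ∀ j, j ∈ E ↔ j = i := by
              intro j
              refine ⟨fun hj => ?_, by rintro rfl; exact hiE⟩
              by_contra hne'
              rcases htie j hne' with h' | h'
              · have := h.low j (hsub hj)
                exact absurd h' (not_lt.2 this)
              · exact h' (((hE j).1 hj).2.trans hbi.symm)
            rw [joinQueue_status_of_alone (P := fun j => θ < a j ∨ c i < c j) hE' hiS h.len, hbi]
            · congr
            intro j _
            refine ⟨fun hj => h.order i hiS j hj, fun hj hj' => ?_⟩
            rcases hj with hj | hj
            · exact absurd hj (not_lt.2 (h.low j hj'))
            · exact absurd hj (not_lt.2 (hbi ▸ hb j hj'))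
          · right; right
            refine ⟨h.join hE hb, mem_activeAgents_joinQueue.2 ⟨hiS, hiE⟩, ?_⟩
            have := card_activeAgents_joinQueue (G := contBadNewsGame T₀) (b := b) hsub hne
            omega
        · have := (nextMessage_eq_some hm).2.1
          rw [h.msgs] at this
          simp at this
  rw [play_eq_stateAfter]
  rcases key 4 with h | ⟨-, -, h⟩ | ⟨-, hiS, h⟩
  · exact h
  · omega
  · have := Finset.card_pos.2 ⟨i, hiS⟩
    omega

/-- Only the bids at histories that can occur matter. -/
lemma play_congr (hT₀ : 1 ≤ T₀) {σ' : Fin 3 → Strategy Unit}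
    (h : ∀ j h t x, (h = [] ∨ ∃ u, 0 < u ∧ u ≤ 2 / 9 ∧ h = [((), u)]) → σ j h t x = σ' j h t x) :
    play (contBadNewsGame T₀) σ v θ = play (contBadNewsGame T₀) σ' v θ := by
  rw [play_eq_stateAfter, play_eq_stateAfter]
  have key : ∀ m, stateAfter T₀ σ v θ m = stateAfter T₀ σ' v θ m := by
    intro m
    induction m with
    | zero => rfl
    | succ m ih =>
      rw [stateAfter_succ, stateAfter_succ, ← ih]
      have hm : messages (stateAfter T₀ σ v θ m).hist = [] ∨
          ∃ u, 0 < u ∧ u ≤ 2 / 9 ∧ messages (stateAfter T₀ σ v θ m).hist = [((), u)] := by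
        rcases messages_stateAfter (σ := σ) (v := v) (θ := θ) hT₀ m with h' | ⟨h', h0, h1, -⟩
        · exact Or.inl h'.msgs
        · exact Or.inr ⟨θ, h0, h1, h'⟩
      generalize stateAfter T₀ σ v θ m = S at hm
      have hb : ∀ j, sealedBid (contBadNewsGame T₀) (σ j) S.hist (v j) =
          sealedBid (contBadNewsGame T₀) (σ' j) S.hist (v j) := by
        intro j
        exact h j _ _ _ hm
      simp only [step, hb]
  exact key 4

end BadNews

/-! ### The bidding functions -/

lemma bNN_radicand_pos {v : ℝ} (h0 : 0 ≤ v) (h1 : v ≤ 1 / 2) :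
    0 < 144 * v ^ 4 - 216 * v ^ 3 + 33 * v ^ 2 + 72 * v + 16 := by
  have h3 : v ^ 3 ≤ v * (1 / 4) := by
    have : v ^ 2 ≤ 1 / 4 := by nlinarith
    nlinarith
  have := sq_nonneg v
  have : 0 ≤ v ^ 4 := by positivity
  nlinarith

/-- `bNN v` as a solution of a linear equation in the square root. -/
lemma bNN_slope {v : ℝ} (h1 : v ≤ 1 / 2) :
    36 * (1 - v) * bNN v + (12 * v ^ 2 - 9 * v + 4) =
      Real.sqrt (144 * v ^ 4 - 216 * v ^ 3 + 33 * v ^ 2 + 72 * v + 16) := by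
  have : 1 - v ≠ 0 := by linarith
  rw [bNN]; field_simp; ring

lemma bNN_slope_pos {v : ℝ} (h0 : 0 ≤ v) (h1 : v ≤ 1 / 2) :
    0 < 36 * (1 - v) * bNN v + (12 * v ^ 2 - 9 * v + 4) := by
  rw [bNN_slope h1]
  exact Real.sqrt_pos.2 (bNN_radicand_pos h0 h1)

/-- The indifference condition that determines `bNN`. -/
lemma bNN_quadratic {v : ℝ} (h0 : 0 ≤ v) (h1 : v ≤ 1 / 2) :
    18 * (1 - v) * bNN v ^ 2 + (12 * v ^ 2 - 9 * v + 4) * bNN v - 2 * v = 0 := by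
  have h := Real.sq_sqrt (bNN_radicand_pos h0 h1).le
  rw [← bNN_slope h1] at h
  have h2 : 0 < 1 - v := by linarith
  have : 72 * (1 - v) * (18 * (1 - v) * bNN v ^ 2 + (12 * v ^ 2 - 9 * v + 4) * bNN v - 2 * v) = 0 := by
    linear_combination h
  rcases mul_eq_zero.1 this with h' | h'
  · linarith
  · exact h'

lemma bNN_zero : bNN 0 = 0 := by
  have : Real.sqrt 16 = 4 := by
    rw [show (16 : ℝ) = 4 ^ 2 by norm_num]; exact Real.sqrt_sq (by norm_num)
  simp [bNN, this]

lemma bNN_half : bNN (1 / 2) = 2 / 9 := by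
  have : Real.sqrt (144 * (1 / 2) ^ 4 - 216 * (1 / 2) ^ 3 + 33 * (1 / 2) ^ 2 + 72 * (1 / 2) + 16) =
      13 / 2 := by
    rw [show (144 * (1 / 2) ^ 4 - 216 * (1 / 2) ^ 3 + 33 * (1 / 2) ^ 2 + 72 * (1 / 2) + 16 : ℝ) =
      (13 / 2) ^ 2 by norm_num]
    exact Real.sqrt_sq (by norm_num)
  rw [bNN, this]; norm_num

lemma differentiableAt_bNN {v : ℝ} (h0 : 0 ≤ v) (h1 : v ≤ 1 / 2) : DifferentiableAt ℝ bNN v := by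
  have h := (bNN_radicand_pos h0 h1).ne'
  have h2 : 36 * (1 - v) ≠ 0 := by
    have : 0 < 1 - v := by linarith
    positivity
  unfold bNN
  refine DifferentiableAt.div (DifferentiableAt.sub (DifferentiableAt.add (DifferentiableAt.sub
    (DifferentiableAt.sqrt (by fun_prop) h) (by fun_prop)) (by fun_prop)) (by fun_prop))
    (by fun_prop) h2

lemma continuousOn_bNN : ContinuousOn bNN (Set.Icc 0 (1 / 2)) := fun _ hv =>
  (differentiableAt_bNN hv.1 hv.2).continuousAt.continuousWithinAt

/-- Implicit differentiation of `bNN_quadratic`. The factor on the left is the derivative of the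
quadratic in the bid. -/
lemma deriv_bNN {v : ℝ} (h0 : 0 < v) (h1 : v < 1 / 2) :
    deriv bNN v * (36 * (1 - v) * bNN v + (12 * v ^ 2 - 9 * v + 4)) =
      18 * bNN v ^ 2 - (24 * v - 9) * bNN v + 2 := by
  have hb := (differentiableAt_bNN h0.le h1.le).hasDerivAt
  have hF : HasDerivAt (fun u => 18 * (1 - u) * bNN u ^ 2 + (12 * u ^ 2 - 9 * u + 4) * bNN u - 2 * u)
      (((18 * (-1)) * bNN v ^ 2 + 18 * (1 - v) * (2 * bNN v * deriv bNN v)) +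
        ((12 * (2 * v) - 9) * bNN v + (12 * v ^ 2 - 9 * v + 4) * deriv bNN v) - 2) v := by
    have hid := hasDerivAt_id' v
    have e1 : HasDerivAt (fun u : ℝ => 18 * (1 - u)) (18 * (-1)) v := by
      simpa using (hid.const_sub 1).const_mul 18
    have e2 : HasDerivAt (fun u : ℝ => 12 * u ^ 2 - 9 * u + 4) (12 * (2 * v) - 9) v := by
      simpa using (((hid.fun_pow 2).const_mul 12).fun_sub (hid.const_mul 9)).add_const 4
    have e3 : HasDerivAt (fun u => bNN u ^ 2) (2 * bNN v * deriv bNN v) v := by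
      simpa using hb.fun_pow 2
    simpa using ((e1.fun_mul e3).fun_add (e2.fun_mul hb)).fun_sub (hid.const_mul 2)
  have h0' : HasDerivAt (fun u => 18 * (1 - u) * bNN u ^ 2 + (12 * u ^ 2 - 9 * u + 4) * bNN u - 2 * u)
      0 v := by
    refine (hasDerivAt_const v (0 : ℝ)).congr_of_eventuallyEq ?_
    filter_upwards [Ioo_mem_nhds h0 h1] with u hu
    exact bNN_quadratic hu.1.le hu.2.le
  have := hF.unique h0'
  linear_combination this

/-- On 0 < v < 1/2 the coefficient 24v - 9 lies in (-9, 3), so the right side of `deriv_bNN` is a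
quadratic in the bid with negative discriminant. -/
lemma deriv_bNN_pos_of_bound {v : ℝ} (h0 : 0 < v) (h1 : v < 1 / 2) (hb : bNN v < 2 / 3) :
    0 < deriv bNN v := by
  have h := deriv_bNN h0 h1
  have hs := bNN_slope_pos h0.le h1.le
  have : 0 < 18 * bNN v ^ 2 - (24 * v - 9) * bNN v + 2 := by
    rcases le_or_gt 0 (bNN v) with hb' | hb' <;> nlinarith [sq_nonneg (bNN v)]
  rw [← h] at this
  exact pos_of_mul_pos_left this hs.le

/-- The quadratic is increasing in the bid. -/
lemma le_bNN_of_quadratic_nonpos {v b : ℝ} (h0 : 0 ≤ v) (h1 : v ≤ 1 / 2)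
    (h : 18 * (1 - v) * b ^ 2 + (12 * v ^ 2 - 9 * v + 4) * b - 2 * v ≤ 0) : b ≤ bNN v := by
  have hq := bNN_quadratic h0 h1
  have hs := bNN_slope_pos h0 h1
  by_contra hlt
  push Not at hlt
  have : 0 < (b - bNN v) * (18 * (1 - v) * (b - bNN v) +
      (36 * (1 - v) * bNN v + (12 * v ^ 2 - 9 * v + 4))) := by
    refine mul_pos (by linarith) (add_pos_of_nonneg_of_pos ?_ hs)
    exact mul_nonneg (by linarith) (by linarith)
  nlinarith

/-- The difference of the quadratic at `bNN v` and at b is (`bNN v` - b)(18(1-v)(b + `bNN v`) + 12v²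
- 9v + 4). If 0 ≤ b < `bNN v`, both factors are positive, while the quadratic vanishes at `bNN v`.
-/
lemma bNN_le_of_quadratic_nonneg {v b : ℝ} (h0 : 0 ≤ v) (h1 : v ≤ 1 / 2) (hb : 0 ≤ b)
    (h : 0 ≤ 18 * (1 - v) * b ^ 2 + (12 * v ^ 2 - 9 * v + 4) * b - 2 * v) : bNN v ≤ b := by
  have hq := bNN_quadratic h0 h1
  have hs := bNN_slope_pos h0 h1
  by_contra hlt
  push Not at hlt
  have h3 : 0 < 18 * (1 - v) * (b + bNN v) + (12 * v ^ 2 - 9 * v + 4) := by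
    have : 0 ≤ 18 * (1 - v) * b := mul_nonneg (by linarith) hb
    nlinarith
  nlinarith [mul_pos (sub_pos.2 hlt) h3]

lemma bNN_nonneg {v : ℝ} (h0 : 0 ≤ v) (h1 : v ≤ 1 / 2) : 0 ≤ bNN v :=
  le_bNN_of_quadratic_nonpos h0 h1 (by simp; linarith)

/-- At the bid v the quadratic equals 2v + 9v² - 6v³, which is nonnegative on [0, 1/2]. -/
lemma bNN_le_self {v : ℝ} (h0 : 0 ≤ v) (h1 : v ≤ 1 / 2) : bNN v ≤ v :=
  bNN_le_of_quadratic_nonneg h0 h1 h0 (by nlinarith [mul_nonneg h0 h0, mul_nonneg (mul_nonneg h0 h0) h0])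

lemma deriv_bNN_pos {v : ℝ} (h0 : 0 < v) (h1 : v < 1 / 2) : 0 < deriv bNN v :=
  deriv_bNN_pos_of_bound h0 h1 ((bNN_le_self h0.le h1.le).trans_lt (by linarith))

lemma strictMonoOn_bNN : StrictMonoOn bNN (Set.Icc 0 (1 / 2)) := by
  refine strictMonoOn_of_deriv_pos (convex_Icc _ _) continuousOn_bNN fun v hv => ?_
  rw [interior_Icc] at hv
  exact deriv_bNN_pos hv.1 hv.2

lemma bNN_lt {v : ℝ} (h0 : 0 ≤ v) (h1 : v < 1 / 2) : bNN v < 2 / 9 := by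
  rw [← bNN_half]
  exact strictMonoOn_bNN ⟨h0, h1.le⟩ ⟨by norm_num, le_rfl⟩ h1

lemma bNN_le {v : ℝ} (h0 : 0 ≤ v) (h1 : v ≤ 1 / 2) : bNN v ≤ 2 / 9 := by
  rw [← bNN_half]
  exact strictMonoOn_bNN.monotoneOn ⟨h0, h1⟩ ⟨by norm_num, le_rfl⟩ h1

lemma strictMonoOn_bYN : StrictMonoOn bYN (Set.Icc 0 (1 / 2)) := by
  intro x hx y hy hxy
  have hx' : x < 1 / 2 := hxy.trans_le hy.2
  have h1 : 0 < (1 - x) := by linarith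
  have h2 : 0 < (1 - y) := by linarith [hy.2]
  -- Up to a positive constant this is the cross-multiplied difference of `bYN y` and `bYN x`. The
  -- second factor is positive because 1 - x > 1/2 and 1 - y ≥ 1/2.
  have key : 0 < (y - x) * (2 * ((1 - x) * (1 - y)) - 1 / 2) := by
    refine mul_pos (by linarith) ?_
    nlinarith [mul_le_mul_of_nonneg_left hy.2 h1.le]
  rw [bYN, bYN, div_lt_div_iff₀ (by linarith) (by linarith)]
  nlinarith

lemma continuousOn_bYN : ContinuousOn bYN (Set.Icc 0 (1 / 2)) := by
  unfold bYN
  refine ContinuousOn.div (by fun_prop) (by fun_prop) fun v hv => ?_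
  have := hv.2
  have : 0 < 3 * (2 * (1 / 2) - v) := by linarith
  exact this.ne'

lemma bYN_zero : bYN 0 = 0 := by simp [bYN]

lemma bYN_nonneg {v : ℝ} (h0 : 0 ≤ v) (h1 : v ≤ 1 / 2) : 0 ≤ bYN v := by
  rw [← bYN_zero]
  exact strictMonoOn_bYN.monotoneOn ⟨le_rfl, by norm_num⟩ ⟨h0, h1⟩ h0

lemma bYN_mul {v : ℝ} (h1 : v ≤ 1 / 2) : (1 - v) * bYN v = v * (1 / 2 - 2 / 3 * v) := by
  have : 1 - v ≠ 0 := by linarith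
  rw [bYN]; field_simp

/-- The message makes the agents wait longer. -/
lemma bYN_le_bNN {v : ℝ} (h0 : 0 ≤ v) (h1 : v ≤ 1 / 2) : bYN v ≤ bNN v := by
  refine le_bNN_of_quadratic_nonpos h0 h1 ?_
  have h := bYN_mul h1
  have h2 : 0 < 1 - v := by linarith
  have : (1 - v) * (18 * (1 - v) * bYN v ^ 2 + (12 * v ^ 2 - 9 * v + 4) * bYN v - 2 * v) =
      -(2 / 3) * v ^ 2 := by
    linear_combination (18 * ((1 - v) * bYN v + v * (1 / 2 - 2 / 3 * v)) +
      (12 * v ^ 2 - 9 * v + 4)) * h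
  have h3 : (1 - v) * (18 * (1 - v) * bYN v ^ 2 + (12 * v ^ 2 - 9 * v + 4) * bYN v - 2 * v) ≤ 0 := by
    rw [this]; nlinarith [sq_nonneg v]
  exact nonpos_of_mul_nonpos_right h3 h2

lemma strictMonoOn_bI : StrictMonoOn bI (Set.Icc 0 1) := by
  intro x hx y hy hxy
  have h1 : 1 < (2 - x) := by linarith [hy.2]
  have h2 : 1 ≤ (2 - y) := by linarith [hy.2]
  have key : 0 < (y - x) * (2 * ((2 - x) * (2 - y) - 1)) := by
    refine mul_pos (by linarith) ?_
    nlinarith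
  rw [bI, bI, div_lt_div_iff₀ (by linarith) (by linarith)]
  nlinarith

lemma continuousOn_bI : ContinuousOn bI (Set.Icc 0 1) := by
  unfold bI
  refine ContinuousOn.div (by fun_prop) (by fun_prop) fun v hv => ?_
  have := hv.2
  have : 0 < 3 * (2 - v) := by linarith
  exact this.ne'

lemma bI_half : bI (1 / 2) = 2 / 9 := by norm_num [bI]

lemma bI_one : bI 1 = 1 / 3 := by norm_num [bI]

lemma measurable_bNN : Measurable bNN := by unfold bNN; fun_prop
lemma measurable_bYN : Measurable bYN := by unfold bYN; fun_prop
lemma measurable_bI : Measurable bI := by unfold bI; fun_prop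

/-! ### The initial bids -/

open Classical in
/-- The sealed bids at the start. -/
def initialBid (v : ℝ) : ℝ := if 1 / 2 ≤ v then bI v else bNN v

lemma initialBid_of_le {v : ℝ} (h : 1 / 2 ≤ v) : initialBid v = bI v := if_pos h

lemma initialBid_of_lt {v : ℝ} (h : v < 1 / 2) : initialBid v = bNN v := if_neg (not_le.2 h)

lemma initialBid_of_le_half {v : ℝ} (h : v ≤ 1 / 2) : initialBid v = bNN v := by
  rcases h.lt_or_eq with h | rfl
  · exact initialBid_of_lt h
  · rw [initialBid_of_le le_rfl, bI_half, bNN_half]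

lemma measurable_initialBid : Measurable initialBid :=
  Measurable.ite measurableSet_Ici measurable_bI measurable_bNN

lemma le_initialBid {v : ℝ} (h0 : 1 / 2 ≤ v) (h1 : v ≤ 1) : 2 / 9 ≤ initialBid v := by
  rw [initialBid_of_le h0, ← bI_half]
  exact strictMonoOn_bI.monotoneOn ⟨by norm_num, by norm_num⟩ ⟨by linarith, h1⟩ h0

lemma initialBid_lt {v : ℝ} (h0 : 0 ≤ v) (h1 : v < 1 / 2) : initialBid v < 2 / 9 := by
  rw [initialBid_of_lt h1]; exact bNN_lt h0 h1

lemma initialBid_lt_iff {v : ℝ} (h0 : 0 ≤ v) (h1 : v ≤ 1) : initialBid v < 2 / 9 ↔ v < 1 / 2 :=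
  ⟨fun h => not_le.1 fun h' => absurd (le_initialBid h' h1) (not_le.2 h), initialBid_lt h0⟩

lemma strictMonoOn_initialBid : StrictMonoOn initialBid (Set.Icc 0 1) := by
  intro x hx y hy hxy
  rcases lt_or_ge y (1 / 2) with h | h
  · rw [initialBid_of_lt h, initialBid_of_lt (hxy.trans h)]
    exact strictMonoOn_bNN ⟨hx.1, (hxy.trans h).le⟩ ⟨hy.1, h.le⟩ hxy
  · rcases lt_or_ge x (1 / 2) with h' | h'
    · exact (initialBid_lt hx.1 h').trans_le (le_initialBid h hy.2)
    · rw [initialBid_of_le h, initialBid_of_le h']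
      exact strictMonoOn_bI hx hy hxy

lemma initialBid_mem {v : ℝ} (h0 : 0 ≤ v) (h1 : v ≤ 1) : initialBid v ∈ Set.Icc 0 (1 / 3) := by
  have e0 : initialBid 0 = 0 := by rw [initialBid_of_lt (by norm_num), bNN_zero]
  have e1 : initialBid 1 = 1 / 3 := by rw [initialBid_of_le (by norm_num), bI_one]
  have := strictMonoOn_initialBid.monotoneOn
  constructor
  · rw [← e0]; exact this ⟨le_rfl, by norm_num⟩ ⟨h0, h1⟩ h0
  · rw [← e1]; exact this ⟨h0, h1⟩ ⟨by norm_num, le_rfl⟩ h1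

/-! ### The highest type outside the queue -/

/-- The highest type that is still outside at the clock time `t ≤ 2 / 9`: the inverse of `bNN`. -/
def outsideType (t : ℝ) : ℝ := sSup {v | v ∈ Set.Icc (0 : ℝ) (1 / 2) ∧ bNN v ≤ t}

lemma outsideType_bddAbove (t : ℝ) :
    BddAbove {v | v ∈ Set.Icc (0 : ℝ) (1 / 2) ∧ bNN v ≤ t} :=
  ⟨1 / 2, fun _ hv => hv.1.2⟩

lemma outsideType_mem (t : ℝ) : outsideType t ∈ Set.Icc (0 : ℝ) (1 / 2) :=
  ⟨Real.sSup_nonneg fun _ hv => hv.1.1, Real.sSup_le (fun _ hv => hv.1.2) (by norm_num)⟩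

lemma outsideType_bNN {v : ℝ} (hv : v ∈ Set.Icc (0 : ℝ) (1 / 2)) : outsideType (bNN v) = v :=
  IsGreatest.csSup_eq ⟨⟨hv, le_rfl⟩, fun _ hu => (strictMonoOn_bNN.le_iff_le hu.1 hv).1 hu.2⟩

lemma bNN_outsideType {t : ℝ} (ht : t ∈ Set.Icc (0 : ℝ) (2 / 9)) : bNN (outsideType t) = t := by
  have := intermediate_value_Icc (by norm_num : (0 : ℝ) ≤ 1 / 2) continuousOn_bNN
  rw [bNN_zero, bNN_half] at this
  obtain ⟨v, hv, rfl⟩ := this ht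
  rw [outsideType_bNN hv]

lemma monotone_outsideType : Monotone outsideType := by
  intro s t hst
  -- The set is empty for negative s, where the supremum takes its default value 0. With this
  -- default the function is monotone on all of ℝ, hence measurable.
  rcases Set.eq_empty_or_nonempty {v | v ∈ Set.Icc (0 : ℝ) (1 / 2) ∧ bNN v ≤ s} with h | h
  · rw [outsideType, h, Real.sSup_empty]
    exact (outsideType_mem t).1
  · exact csSup_le_csSup (outsideType_bddAbove t) h fun v hv => ⟨hv.1, hv.2.trans hst⟩

/-- A monotone function whose image is a neighbourhood of the value has no jump there. The image
contains (0, 1/2), since each type v in it is recovered from its bid `bNN v`. -/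
lemma continuousAt_outsideType {t : ℝ} (ht : t ∈ Set.Ioo (0 : ℝ) (2 / 9)) :
    ContinuousAt outsideType t := by
  refine continuousAt_of_monotoneOn_of_image_mem_nhds (monotone_outsideType.monotoneOn _)
    (Icc_mem_nhds ht.1 ht.2) ?_
  have hw := outsideType_mem t
  have hb := bNN_outsideType ⟨ht.1.le, ht.2.le⟩
  have h0 : 0 < outsideType t := hw.1.lt_of_ne fun h => by
    rw [← h, bNN_zero] at hb; exact ht.1.ne hb
  have h1 : outsideType t < 1 / 2 := hw.2.lt_of_ne fun h => by
    rw [h, bNN_half] at hb; exact ht.2.ne' hb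
  refine Filter.mem_of_superset (Ioo_mem_nhds h0 h1) fun v hv => ?_
  exact ⟨bNN v, ⟨bNN_nonneg hv.1.le hv.2.le, bNN_le hv.1.le hv.2.le⟩,
    outsideType_bNN ⟨hv.1.le, hv.2.le⟩⟩

lemma lt_initialBid_iff {v t : ℝ} (h0 : 0 ≤ v) (h1 : v ≤ 1) (ht : t ∈ Set.Icc (0 : ℝ) (2 / 9)) :
    t < initialBid v ↔ outsideType t < v := by
  have hw := outsideType_mem t
  have : initialBid (outsideType t) = t := by
    rw [initialBid_of_le_half hw.2, bNN_outsideType ht]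
  conv_lhs => rw [← this]
  exact strictMonoOn_initialBid.lt_iff_lt ⟨hw.1, hw.2.trans (by norm_num)⟩ ⟨h0, h1⟩

/-- Bids after a message at time `t`. -/
def laterBid (t v : ℝ) : ℝ := bYN (min v (outsideType t))

/-- With w = `outsideType t` and t ≤ 2/9, truncating the type at w gives `bYN (min v w)` ≤ `bNN (min
v w)` ≤ `bNN w` = t. Without the truncation, an agent who had failed to enter in time might be told
to bid above the clock. -/
lemma laterBid_mem {t v : ℝ} (ht : 0 ≤ t) (h0 : 0 ≤ v) : laterBid t v ∈ Set.Icc 0 t := by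
  have hw := outsideType_mem t
  have hm0 : 0 ≤ min v (outsideType t) := le_min h0 hw.1
  have hm1 : min v (outsideType t) ≤ 1 / 2 := (min_le_right _ _).trans hw.2
  refine ⟨bYN_nonneg hm0 hm1, (bYN_le_bNN hm0 hm1).trans ?_⟩
  rcases le_total t (2 / 9) with h | h
  · conv_rhs => rw [← bNN_outsideType ⟨ht, h⟩]
    refine strictMonoOn_bNN.monotoneOn ⟨hm0, hm1⟩ hw ?_
    exact min_le_right _ _
  · exact (bNN_le hm0 hm1).trans h

lemma measurable_laterBid : Measurable fun p : ℝ × ℝ => laterBid p.1 p.2 :=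
  measurable_bYN.comp (measurable_snd.min (monotone_outsideType.measurable.comp measurable_fst))

lemma _root_.Measurable.laterBid {X : Type*} [MeasurableSpace X] {f g : X → ℝ} (hf : Measurable f)
    (hg : Measurable g) : Measurable fun a => laterBid (f a) (g a) :=
  measurable_laterBid.comp (hf.prodMk hg)

/-! ### Optimal bids -/

/-- The probability that the opponents are of type below `1 / 2` and not both of type
above `z`, times the gain of type `x` from bidding `bYN z`. -/
def postGain (z x : ℝ) : ℝ := (z - z ^ 2) * x - z ^ 2 / 2 + 2 / 3 * z ^ 3

lemma postGain_eq {z : ℝ} (x : ℝ) (h1 : z ≤ 1 / 2) :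
    (z - z ^ 2) * (x - bYN z) = postGain z x := by
  rw [postGain]
  linear_combination (-z) * bYN_mul h1

/-- The z-derivative is (1-2z)(x-z), so the gain is single-peaked at x, and on z ≤ w the peak is at
min x w. The proof uses the exact identity `postGain x x` - `postGain z x` = (x-z)²(1/2 - x/3 -
2z/3). If x ≥ w, this is applied at w, and the linearity in x contributes (w-z)(1-w-z)(x-w). -/
lemma postGain_le {z w x : ℝ} (hzw : z ≤ w) (hw : w ≤ 1 / 2) :
    postGain z x ≤ postGain (min x w) x := by
  rcases le_total x w with h | h
  · rw [min_eq_left h]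
    have : 0 ≤ (x - z) ^ 2 * (1 / 2 - x / 3 - 2 * z / 3) :=
      mul_nonneg (sq_nonneg _) (by linarith)
    unfold postGain
    nlinarith
  · rw [min_eq_right h]
    have h1 : 0 ≤ (w - z) ^ 2 * (1 / 2 - w / 3 - 2 * z / 3) :=
      mul_nonneg (sq_nonneg _) (by linarith)
    have h2 : 0 ≤ (w - z) * (1 - w - z) * (x - w) :=
      mul_nonneg (mul_nonneg (by linarith) (by linarith)) (by linarith)
    unfold postGain
    nlinarith

/-- The gain of type `x ≥ 1 / 2` from bidding `bI y`. -/
def earlyGain (x y : ℝ) : ℝ := (2 * y - y ^ 2) * x - y ^ 2 * (3 - 2 * y) / 3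

lemma earlyGain_eq (x : ℝ) {y : ℝ} (h1 : y ≤ 1) :
    (x - bI y) * (1 - (1 - y) ^ 2) = earlyGain x y := by
  have : 2 - y ≠ 0 := by linarith
  rw [earlyGain, bI]; field_simp; ring

/-- The y-derivative is 2(1-y)(x-y), so the gain is single-peaked at x. The proof uses the exact
identity `earlyGain x x` - `earlyGain x y` = (x-y)²(1 - x/3 - 2y/3). A type below 1/2 is compared
with the boundary type 1/2, with a further term linear in 1/2 - x. -/
lemma earlyGain_le {x y : ℝ} (hx : x ≤ 1) (hy : 1 / 2 ≤ y) (hy1 : y ≤ 1) :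
    earlyGain x y ≤ earlyGain x (max x (1 / 2)) := by
  rcases le_total x (1 / 2) with h | h
  · rw [max_eq_right h]
    have h1 : 0 ≤ (1 / 2 - y) ^ 2 * (1 - (1 / 2) / 3 - 2 * y / 3) :=
      mul_nonneg (sq_nonneg _) (by linarith)
    have h2 : 0 ≤ (y - 1 / 2) * (2 - y - 1 / 2) * (1 / 2 - x) :=
      mul_nonneg (mul_nonneg (by linarith) (by linarith)) (by linarith)
    unfold earlyGain
    nlinarith
  · rw [max_eq_left h]
    have : 0 ≤ (x - y) ^ 2 * (1 - x / 3 - 2 * y / 3) :=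
      mul_nonneg (sq_nonneg _) (by linarith)
    unfold earlyGain
    nlinarith

/-- The gain of type `x` after a message at time `t`. -/
def messageGain (x t : ℝ) : ℝ := postGain (min x (outsideType t)) x

lemma measurable_messageGain (x : ℝ) : Measurable (messageGain x) := by
  have := monotone_outsideType.measurable
  unfold messageGain postGain
  fun_prop

lemma abs_messageGain_le {x : ℝ} (hx : x ∈ Set.Icc (0 : ℝ) 1) (t : ℝ) : |messageGain x t| ≤ 1 := by
  have hw := outsideType_mem t
  have h0 : 0 ≤ min x (outsideType t) := le_min hx.1 hw.1
  have h1 : min x (outsideType t) ≤ 1 / 2 := (min_le_right _ _).trans hw.2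
  unfold messageGain postGain
  generalize min x (outsideType t) = z at h0 h1
  have h2 : z ^ 2 ≤ 1 / 4 := by nlinarith
  have h3 : 0 ≤ z ^ 2 := sq_nonneg z
  have h4 : 0 ≤ (z - z ^ 2) * x := mul_nonneg (by nlinarith) hx.1
  have h5 : (z - z ^ 2) * x ≤ 1 / 2 :=
    (mul_le_of_le_one_right (by nlinarith) hx.2).trans (by linarith)
  have h6 : 0 ≤ z ^ 3 := by positivity
  have h7 : z ^ 3 ≤ 1 / 8 := by nlinarith
  rw [abs_le]; constructor <;> linarith

lemma intervalIntegrable_messageGain {x : ℝ} (hx : x ∈ Set.Icc (0 : ℝ) 1) (a b : ℝ) :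
    IntervalIntegrable (messageGain x) volume a b := by
  refine (intervalIntegrable_const (c := (1 : ℝ))).mono_fun
    (measurable_messageGain x).aestronglyMeasurable (Filter.Eventually.of_forall fun t => ?_)
  simpa using abs_messageGain_le hx t

/-- The gain of type `x` from the initial bid `bNN y`, with optimal bids after the message. -/
def waitGain (x y : ℝ) : ℝ :=
  9 / 2 * (∫ t in bNN y..2 / 9, messageGain x t) +
    (x - bNN y) * (y + 9 / 2 * bNN y * (y - y ^ 2))

/-- The pasting condition: at the bid 2/9 no message can come first, except at the endpoint seed of
probability zero. Hence the gains of the two regimes coincide there. -/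
lemma waitGain_half (x : ℝ) : waitGain x (1 / 2) = earlyGain x (1 / 2) := by
  rw [waitGain, earlyGain, bNN_half, intervalIntegral.integral_same]; ring

lemma continuousOn_waitGain {x : ℝ} (hx : x ∈ Set.Icc (0 : ℝ) 1) :
    ContinuousOn (waitGain x) (Set.Icc 0 (1 / 2)) := by
  have h1 : Continuous fun b => ∫ t in b..2 / 9, messageGain x t := by
    have := intervalIntegral.continuous_primitive
      (fun a b => intervalIntegrable_messageGain hx a b) (2 / 9)
    simp_rw [fun b => intervalIntegral.integral_symm (f := messageGain x) (μ := volume) (2 / 9) b]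
    exact this.neg
  have hb := continuousOn_bNN
  have h2 : ContinuousOn (fun y => ∫ t in bNN y..2 / 9, messageGain x t) (Set.Icc 0 (1 / 2)) :=
    h1.comp_continuousOn hb
  unfold waitGain
  fun_prop

/-- The fundamental theorem of calculus at the lower endpoint, with the chain rule. At a message
time `bNN y` the highest type outside is y, which turns the integrand into `postGain (min x y) x`.
-/
lemma hasDerivAt_waitGain {x y : ℝ} (hx : x ∈ Set.Icc (0 : ℝ) 1) (hy : y ∈ Set.Ioo (0 : ℝ) (1 / 2)) :
    HasDerivAt (waitGain x)
      (deriv bNN y * (-(9 / 2) * postGain (min x y) x - (y + 9 / 2 * bNN y * (y - y ^ 2)) +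
          (x - bNN y) * (9 / 2 * (y - y ^ 2))) +
        (x - bNN y) * (1 + 9 / 2 * bNN y * (1 - 2 * y))) y := by
  have hb := (differentiableAt_bNN hy.1.le hy.2.le).hasDerivAt
  have hmem : bNN y ∈ Set.Ioo (0 : ℝ) (2 / 9) := by
    constructor
    · rw [← bNN_zero]
      exact strictMonoOn_bNN ⟨le_rfl, by norm_num⟩ ⟨hy.1.le, hy.2.le⟩ hy.1
    · exact bNN_lt hy.1.le hy.2
  have hcont : ContinuousAt (messageGain x) (bNN y) := by
    have := continuousAt_outsideType hmem
    unfold messageGain postGain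
    fun_prop
  have hI : HasDerivAt (fun b => ∫ t in b..2 / 9, messageGain x t) (-messageGain x (bNN y)) (bNN y) :=
    intervalIntegral.integral_hasDerivAt_left (intervalIntegrable_messageGain hx _ _)
      (measurable_messageGain x).stronglyMeasurable.stronglyMeasurableAtFilter hcont
  have hg : messageGain x (bNN y) = postGain (min x y) x := by
    rw [messageGain, outsideType_bNN ⟨hy.1.le, hy.2.le⟩]
  have h1 := (hI.comp y hb).const_mul (9 / 2)
  have hid := hasDerivAt_id' y
  have h2 : HasDerivAt (fun y => x - bNN y) (-deriv bNN y) y := hb.const_sub x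
  have h3 : HasDerivAt (fun y : ℝ => y - y ^ 2) (1 - 2 * y) y := by
    simpa using hid.fun_sub (hid.fun_pow 2)
  have h4 := hid.add ((hb.const_mul (9 / 2)).mul h3)
  have h5 := h1.add (h2.mul h4)
  refine h5.congr_deriv ?_
  rw [hg]
  simp only [Pi.add_apply, Pi.mul_apply]
  ring

/-- The first-order condition. -/
lemma waitGain_foc {y : ℝ} (hy : y ∈ Set.Ioo (0 : ℝ) (1 / 2)) :
    deriv bNN y * (-(9 / 2) * postGain y y - (y + 9 / 2 * bNN y * (y - y ^ 2)) +
          (y - bNN y) * (9 / 2 * (y - y ^ 2))) +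
        (y - bNN y) * (1 + 9 / 2 * bNN y * (1 - 2 * y)) = 0 := by
  have h1 := deriv_bNN hy.1 hy.2
  have h2 := bNN_quadratic hy.1.le hy.2.le
  unfold postGain
  -- With Q the quadratic of `bNN_quadratic` along `bNN`, the left side is -(yQ)'/4 = -(y/4)Q' -
  -- Q/4. Here `h1` is Q' = 0 and `h2` is Q = 0.
  linear_combination (-(y / 4)) * h1 - (1 / 4) * h2

/-- Subtracting the first-order condition of type u from the derivative at u leaves a term with the
sign of x - u. For u < x the terms with `deriv bNN u` cancel, because x would respond to a message
at `bNN u` by imitating u; what remains is (x-u)(1 + (9/2)`bNN u`(1-2u)). For u > x there is an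
extra nonpositive term: x would then respond with its own optimum, which beats imitating u by
(u-x)²(1/2 - 2u/3 - x/3), and a higher bid forgoes this. -/
lemma waitGain_le {x y : ℝ} (hx : x ∈ Set.Icc (0 : ℝ) 1) (hy : y ∈ Set.Icc (0 : ℝ) (1 / 2)) :
    waitGain x y ≤ waitGain x (min x (1 / 2)) := by
  have hm : min x (1 / 2) ∈ Set.Icc (0 : ℝ) (1 / 2) :=
    ⟨le_min hx.1 (by norm_num), min_le_right _ _⟩
  have hR : ∀ u ∈ Set.Ioo (0 : ℝ) (1 / 2), 0 < 1 + 9 / 2 * bNN u * (1 - 2 * u) := by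
    intro u hu
    have := mul_nonneg (bNN_nonneg hu.1.le hu.2.le) (by linarith [hu.2] : 0 ≤ 1 - 2 * u)
    nlinarith
  rcases le_total y (min x (1 / 2)) with h | h
  · have hmono : MonotoneOn (waitGain x) (Set.Icc 0 (min x (1 / 2))) := by
      refine monotoneOn_of_deriv_nonneg (convex_Icc _ _)
        ((continuousOn_waitGain hx).mono (Set.Icc_subset_Icc_right hm.2)) ?_ ?_
      · intro u hu
        rw [interior_Icc] at hu
        exact (hasDerivAt_waitGain hx ⟨hu.1, hu.2.trans_le hm.2⟩).differentiableAt.differentiableWithinAt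
      · intro u hu
        rw [interior_Icc] at hu
        have hu' : u ∈ Set.Ioo (0 : ℝ) (1 / 2) := ⟨hu.1, hu.2.trans_le hm.2⟩
        have hux : u < x := hu.2.trans_le (min_le_left _ _)
        rw [(hasDerivAt_waitGain hx hu').deriv, min_eq_right hux.le]
        have hfoc := waitGain_foc hu'
        have := mul_pos (sub_pos.2 hux) (hR u hu')
        unfold postGain at hfoc ⊢
        nlinarith
    exact hmono ⟨hy.1, h⟩ ⟨hm.1, le_rfl⟩ h
  · have hanti : AntitoneOn (waitGain x) (Set.Icc (min x (1 / 2)) (1 / 2)) := by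
      refine antitoneOn_of_deriv_nonpos (convex_Icc _ _)
        ((continuousOn_waitGain hx).mono (Set.Icc_subset_Icc_left hm.1)) ?_ ?_
      · intro u hu
        rw [interior_Icc] at hu
        exact (hasDerivAt_waitGain hx ⟨hm.1.trans_lt hu.1, hu.2⟩).differentiableAt.differentiableWithinAt
      · intro u hu
        rw [interior_Icc] at hu
        have hu' : u ∈ Set.Ioo (0 : ℝ) (1 / 2) := ⟨hm.1.trans_lt hu.1, hu.2⟩
        have hux : x < u := by
          rcases min_lt_iff.1 hu.1 with h | h
          · exact h
          · exact absurd h (not_lt.2 hu.2.le)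
        rw [(hasDerivAt_waitGain hx hu').deriv, min_eq_left hux.le]
        have hfoc := waitGain_foc hu'
        have h1 := mul_pos (sub_pos.2 hux) (hR u hu')
        have h2 : 0 ≤ deriv bNN u *
            (9 / 2 * ((u - x) ^ 2 * (1 / 2 - 2 * u / 3 - x / 3))) :=
          mul_nonneg (deriv_bNN_pos hu'.1 hu'.2).le
            (mul_nonneg (by norm_num) (mul_nonneg (sq_nonneg _) (by linarith [hu'.2])))
        unfold postGain at hfoc ⊢
        linarith
    exact hanti ⟨le_rfl, hm.2⟩ ⟨h, hy.2⟩ h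

/-- No initial bid by time `2 / 9` is better than the prescribed one. -/
lemma earlyGain_le_waitGain {x y : ℝ} (hx : x ∈ Set.Icc (0 : ℝ) (1 / 2)) (hy : 1 / 2 ≤ y)
    (hy1 : y ≤ 1) : earlyGain x y ≤ waitGain x x := by
  have h1 := earlyGain_le (x := x) (by linarith [hx.2]) hy hy1
  rw [max_eq_right hx.2, ← waitGain_half] at h1
  have hx' : x ∈ Set.Icc (0 : ℝ) 1 := ⟨hx.1, by linarith [hx.2]⟩
  have h2 := waitGain_le hx' (y := 1 / 2) ⟨by norm_num, le_rfl⟩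
  rw [min_eq_left hx.2] at h2
  exact h1.trans h2

lemma waitGain_le_earlyGain {x y : ℝ} (hx : x ∈ Set.Icc (1 / 2 : ℝ) 1)
    (hy : y ∈ Set.Icc (0 : ℝ) (1 / 2)) : waitGain x y ≤ earlyGain x x := by
  have h2 := waitGain_le (x := x) ⟨by linarith [hx.1], hx.2⟩ hy
  rw [min_eq_right hx.1, waitGain_half] at h2
  have h1 := earlyGain_le hx.2 (le_refl (1 / 2)) (by norm_num)
  rw [max_eq_left hx.1] at h1
  exact h2.trans h1

/-! ### Measurability on message histories -/

section MsgHistoryMeasurable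

variable {M : Type} [MeasurableSpace M]

/-- The σ-algebra on histories is pulled back from the disjoint union of the tuple spaces, so
measurability can be tested separately for each length. -/
lemma measurable_of_ofFn {β : Type*} [MeasurableSpace β] {f : MsgHistory M → β}
    (hf : ∀ n, Measurable fun p : Fin n → M × ℝ => f (List.ofFn p)) : Measurable f := by
  have h : f = (fun q : Σ n, Fin n → M × ℝ => f (List.ofFn q.2)) ∘ List.equivSigmaTuple := by
    funext l
    exact (congrArg f (List.equivSigmaTuple.symm_apply_apply l)).symm
  rw [h]
  refine Measurable.comp ?_ (comap_measurable _)
  intro s hs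
  rw [MeasurableSpace.measurableSet_iInf]
  exact fun n => hf n hs

lemma measurable_length : Measurable fun h : MsgHistory M => h.length :=
  measurable_of_ofFn fun n => by simp

lemma measurableSet_nil : MeasurableSet {h : MsgHistory M | h = []} := by
  have : {h : MsgHistory M | h = []} = (fun h : MsgHistory M => h.length) ⁻¹' {0} := by
    ext h; simp
  rw [this]
  exact measurable_length (measurableSet_singleton 0)

lemma measurable_singleton_history : Measurable fun t : ℝ => ([((), t)] : MsgHistory Unit) := by
  rintro s ⟨u, hu, rfl⟩
  rw [MeasurableSpace.measurableSet_iInf] at hu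
  -- Histories with one message form the summand of index 1 in the disjoint union.
  have h1 := hu 1
  have hm : Measurable fun (t : ℝ) (_ : Fin 1) => ((), t) := by fun_prop
  have := hm h1
  convert this using 1
  ext t
  simp only [Set.mem_preimage]
  have : List.equivSigmaTuple [((), t)] = (⟨1, fun _ => ((), t)⟩ : Σ n, Fin n → Unit × ℝ) := by
    rw [← Equiv.eq_symm_apply]
    simp [List.equivSigmaTuple]
  rw [this]

end MsgHistoryMeasurable

/-! ### The equilibrium strategy -/

open Classical in
/-- Bid `initialBid` at the start and `laterBid` after a message. -/
def eqStrategy : Strategy Unit := fun h t x => if h = [] then initialBid x else laterBid t x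

@[simp] lemma eqStrategy_nil (t x : ℝ) : eqStrategy [] t x = initialBid x := if_pos rfl

@[simp] lemma eqStrategy_singleton (m : Unit × ℝ) (t x : ℝ) :
    eqStrategy [m] t x = laterBid t x := if_neg (by simp)

lemma measurable_eqStrategy :
    Measurable fun p : MsgHistory Unit × ℝ × ℝ => eqStrategy p.1 p.2.1 p.2.2 := by
  refine Measurable.ite (measurable_fst measurableSet_nil) ?_ ?_
  · exact measurable_initialBid.comp (by fun_prop)
  · exact measurable_laterBid.comp (by fun_prop)

lemma feasible_eqStrategy {T₀ : ℝ} (hT₀ : 1 ≤ T₀) : Feasible (contBadNewsGame T₀) eqStrategy := by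
  refine ⟨measurable_eqStrategy, fun x hx => ?_, fun h m t ht x hx => ?_⟩
  · have := initialBid_mem hx.1 hx.2
    rw [eqStrategy_nil]
    exact ⟨this.1, this.2.trans_lt (by change 1 / 3 < T₀; linarith)⟩
  · rw [eqStrategy, if_neg (by simp)]
    exact laterBid_mem ht.le hx.1

/-! ### The prior -/

/-- The law of a value. -/
abbrev valueLaw : Measure ℝ := cond volume (Set.Icc 0 1)

/-- The law of the announcer's seed. -/
abbrev seedLaw : Measure ℝ := cond volume (Set.Icc 0 (2 / 9))

/-- The joint law of the values. -/
abbrev valuesLaw : Measure (Fin 3 → ℝ) := Measure.pi fun _ => valueLaw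

lemma prior_eq (T₀ : ℝ) : prior (contBadNewsGame T₀) = valuesLaw.prod seedLaw := rfl

instance : IsProbabilityMeasure valueLaw :=
  cond_isProbabilityMeasure_of_finite (by simp) (by simp)

instance : IsProbabilityMeasure seedLaw :=
  cond_isProbabilityMeasure_of_finite (by simp) (by simp)

instance (T₀ : ℝ) : IsProbabilityMeasure (prior (contBadNewsGame T₀)) := by
  rw [prior_eq]; infer_instance

lemma valueLaw_eq : valueLaw = volume.restrict (Set.Icc 0 1) := by
  simp [valueLaw, ProbabilityTheory.cond]

lemma seedLaw_eq : seedLaw = (9 / 2 : ℝ).toNNReal • volume.restrict (Set.Icc 0 (2 / 9)) := by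
  rw [seedLaw, ProbabilityTheory.cond, Real.volume_Icc, ← ENNReal.ofReal_inv_of_pos (by norm_num)]
  rw [show (2 / 9 - 0 : ℝ)⁻¹ = 9 / 2 by norm_num]
  rfl

lemma valueLaw_real {S : Set ℝ} {y z : ℝ} (hy : 0 ≤ y) (hyz : y ≤ z) (hz : z ≤ 1)
    (hS : ∀ v ∈ Set.Icc (0 : ℝ) 1, v ∈ S ↔ y < v ∧ v ≤ z) : valueLaw.real S = z - y := by
  have : S ∩ Set.Icc 0 1 = Set.Ioc y z := by
    ext v
    refine ⟨fun h => (hS v h.2).1 h.1, fun h => ?_⟩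
    have hv : v ∈ Set.Icc (0 : ℝ) 1 := ⟨hy.trans h.1.le, h.2.trans hz⟩
    exact ⟨(hS v hv).2 h, hv⟩
  rw [valueLaw_eq, Measure.real, Measure.restrict_apply' measurableSet_Icc, this, Real.volume_Ioc,
    ENNReal.toReal_ofReal (by linarith)]

lemma valueLaw_real_lt {S : Set ℝ} {y z : ℝ} (hy : 0 ≤ y) (hyz : y ≤ z) (hz : z ≤ 1)
    (hS : ∀ v ∈ Set.Icc (0 : ℝ) 1, v ∈ S ↔ y < v ∧ v < z) : valueLaw.real S = z - y := by
  have : S ∩ Set.Icc 0 1 = Set.Ioo y z := by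
    ext v
    refine ⟨fun h => (hS v h.2).1 h.1, fun h => ?_⟩
    have hv : v ∈ Set.Icc (0 : ℝ) 1 := ⟨hy.trans h.1.le, h.2.le.trans hz⟩
    exact ⟨(hS v hv).2 h, hv⟩
  rw [valueLaw_eq, Measure.real, Measure.restrict_apply' measurableSet_Icc, this, Real.volume_Ioo,
    ENNReal.toReal_ofReal (by linarith)]

/-- Both opponents of `i` have values in `S`. -/
def opponentsIn (i : Fin 3) (S : Set ℝ) : Set (Fin 3 → ℝ) := {v | ∀ j ≠ i, v j ∈ S}

lemma mem_opponentsIn {i : Fin 3} {S : Set ℝ} {v : Fin 3 → ℝ} :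
    v ∈ opponentsIn i S ↔ ∀ j ≠ i, v j ∈ S := Iff.rfl

lemma valuesLaw_opponentsIn (i : Fin 3) (S : Set ℝ) :
    valuesLaw (opponentsIn i S) = valueLaw S ^ 2 := by
  classical
  have : opponentsIn i S = Set.univ.pi fun j => if j = i then Set.univ else S := by
    ext v
    simp only [mem_opponentsIn, Set.mem_pi, Set.mem_univ, true_imp_iff]
    refine forall_congr' fun j => ?_
    by_cases h : j = i <;> simp [h]
  rw [this, Measure.pi_pi]
  fin_cases i <;> simp [Fin.prod_univ_three, sq]

lemma valuesLaw_real_opponentsIn (i : Fin 3) (S : Set ℝ) :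
    valuesLaw.real (opponentsIn i S) = valueLaw.real S ^ 2 := by
  rw [Measure.real, valuesLaw_opponentsIn, ENNReal.toReal_pow, Measure.real]

lemma measurableSet_forall_ne {X : Type*} [MeasurableSpace X] (i : Fin 3) {P : Fin 3 → X → Prop}
    (h : ∀ j, MeasurableSet {p | P j p}) : MeasurableSet {p | ∀ j ≠ i, P j p} := by
  simp only [Set.ofPred_forall]
  exact MeasurableSet.iInter fun j => MeasurableSet.iInter fun _ => h j

lemma measurableSet_opponentsIn (i : Fin 3) {S : Set ℝ} (hS : MeasurableSet S) :
    MeasurableSet (opponentsIn i S) :=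
  measurableSet_forall_ne i fun j => measurable_pi_apply j hS

/-- Both opponents of `i` are of types that do not enter by time `2 / 9`. -/
abbrev lowOpponents (i : Fin 3) : Set (Fin 3 → ℝ) := opponentsIn i (Set.Iio (1 / 2))

lemma valuesLaw_real_lowOpponents (i : Fin 3) : valuesLaw.real (lowOpponents i) = 1 / 4 := by
  rw [valuesLaw_real_opponentsIn]
  have : valueLaw.real (Set.Iio (1 / 2)) = 1 / 2 := by
    have e : Set.Iio (1 / 2) ∩ Set.Icc 0 1 = Set.Ico (0 : ℝ) (1 / 2) := by
      ext v
      simp only [Set.mem_inter_iff, Set.mem_Iio, Set.mem_Icc, Set.mem_Ico]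
      constructor
      · rintro ⟨h1, h2, -⟩; exact ⟨h2, h1⟩
      · rintro ⟨h1, h2⟩; exact ⟨h2, h1, by linarith⟩
    rw [valueLaw_eq, Measure.real, Measure.restrict_apply' measurableSet_Icc, e, Real.volume_Ico]
    simp
  rw [this]; norm_num

lemma valuesLaw_lowOpponents_ne_zero (i : Fin 3) : valuesLaw (lowOpponents i) ≠ 0 := by
  intro h
  have := valuesLaw_real_lowOpponents i
  rw [Measure.real, h] at this
  norm_num at this

lemma ae_values_of_ae {P : ℝ → Prop} (h : ∀ᵐ x ∂valueLaw, P x) :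
    ∀ᵐ v ∂valuesLaw, ∀ j, P (v j) := by
  rw [ae_all_iff]
  intro j
  exact (Measure.quasiMeasurePreserving_eval (μ := fun _ : Fin 3 => valueLaw) j).ae h

lemma ae_values_mem : ∀ᵐ v ∂valuesLaw, ∀ j, v j ∈ Set.Icc (0 : ℝ) 1 :=
  ae_values_of_ae (ae_cond_mem measurableSet_Icc)

/-- A set that meets `[0, 1]` in at most one point has probability zero. -/
lemma ae_not_of_subsingleton {P : ℝ → Prop}
    (h : ({x | P x} ∩ Set.Icc 0 1).Subsingleton) : ∀ᵐ x ∂valueLaw, ¬ P x := by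
  rw [valueLaw_eq, ae_iff]
  simp only [not_not]
  rw [Measure.restrict_apply' measurableSet_Icc]
  exact h.measure_zero _

lemma ae_seed_mem : ∀ᵐ θ ∂seedLaw, θ ∈ Set.Ioo (0 : ℝ) (2 / 9) := by
  rw [seedLaw_eq]
  refine (Measure.ae_smul_measure ?_ _)
  rw [← restrict_Ioo_eq_restrict_Icc]
  exact ae_restrict_mem measurableSet_Ioo

lemma integral_seedLaw (f : ℝ → ℝ) :
    ∫ θ, f θ ∂seedLaw = 9 / 2 * ∫ θ in (0 : ℝ)..2 / 9, f θ := by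
  rw [seedLaw_eq, integral_smul_nnreal_measure, intervalIntegral.integral_of_le (by norm_num),
    ← integral_Icc_eq_integral_Ioc]
  norm_num [NNReal.smul_def]

/-- To prove something for almost all values and seeds it suffices to fix the seed. -/
lemma ae_prior_of_ae {P : (Fin 3 → ℝ) × ℝ → Prop} (hP : MeasurableSet {p | P p})
    (h : ∀ᵐ θ ∂seedLaw, ∀ᵐ v ∂valuesLaw, P (v, θ)) : ∀ᵐ p ∂valuesLaw.prod seedLaw, P p := by
  rw [ae_iff]
  change (valuesLaw.prod seedLaw) {p | P p}ᶜ = 0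
  rw [Measure.prod_apply_symm hP.compl]
  rw [lintegral_eq_zero_iff (measurable_measure_prodMk_right hP.compl)]
  filter_upwards [h] with θ hθ
  exact hθ

/-! ### The payoff of an agent against the equilibrium strategy -/

/-- The agent `i` is the only one not to follow the equilibrium strategy. -/
abbrev deviation (i : Fin 3) (d : Strategy Unit) : Fin 3 → Strategy Unit :=
  Function.update (fun _ => eqStrategy) i d

section Payoff

variable {T₀ : ℝ} {i : Fin 3} {d : Strategy Unit} {v : Fin 3 → ℝ} {θ x : ℝ}

open Classical in
lemma utility_of_no_message (hT₀ : 1 ≤ T₀)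
    (hN : 0 < θ → θ ≤ 2 / 9 → (∀ j ≠ i, initialBid (v j) < 2 / 9 ∨ initialBid (v j) ≤ θ) →
      θ < d [] T₀ x)
    (htie : ∀ j ≠ i, initialBid (v j) ≠ d [] T₀ x) :
    utility (contBadNewsGame T₀) (deviation i d) (Function.update v i x) θ i =
      if ∀ j ≠ i, d [] T₀ x < initialBid (v j) then 0 else x - d [] T₀ x := by
  have h := play_status_of_no_message (σ := deviation i d) (v := Function.update v i x) (θ := θ)
    hT₀ i (fun h0 h1 h2 => by
      simpa using hN h0 h1 fun j hj => by simpa [hj] using h2 j hj)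
    (fun j hj => by simpa [hj] using htie j hj)
  rw [utility, h]
  have e : (∀ j ≠ i, deviation i d i [] T₀ (Function.update v i x i) <
      deviation i d j [] T₀ (Function.update v i x j)) ↔
      ∀ j ≠ i, d [] T₀ x < initialBid (v j) :=
    forall₂_congr fun j hj => by simp [hj]
  simp only [e]
  split_ifs <;> simp

open Classical in
lemma utility_of_message (hT₀ : 1 ≤ T₀) (h0 : 0 < θ) (h1 : θ ≤ 2 / 9)
    (hj : ∀ j ≠ i, initialBid (v j) < 2 / 9) (hi : d [] T₀ x ≤ θ)
    (htie : ∀ j ≠ i, θ < initialBid (v j) ∨ laterBid θ (v j) ≠ d [((), θ)] θ x) :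
    utility (contBadNewsGame T₀) (deviation i d) (Function.update v i x) θ i =
      if ∀ j ≠ i, θ < initialBid (v j) ∨ d [((), θ)] θ x < laterBid θ (v j) then 0
      else x - d [((), θ)] θ x := by
  have h := play_status_of_message (σ := deviation i d) (v := Function.update v i x) (θ := θ)
    hT₀ i h0 h1 (fun j hj' => by simpa [hj'] using hj j hj') (by simpa using hi)
    (fun j hj => by simpa [hj] using htie j hj)
  rw [utility, h]
  have e : (∀ j ≠ i, θ < deviation i d j [] T₀ (Function.update v i x j) ∨
      deviation i d i [((), θ)] θ (Function.update v i x i) <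
      deviation i d j [((), θ)] θ (Function.update v i x j)) ↔
      ∀ j ≠ i, θ < initialBid (v j) ∨ d [((), θ)] θ x < laterBid θ (v j) :=
    forall₂_congr fun j hj => by simp [hj]
  simp only [e]
  split_ifs <;> simp

end Payoff

open Classical in
/-- The payoff of agent `i` with value `x` who bids `b` initially and `c t` after a message at
time `t`, up to ties. -/
def payoff (i : Fin 3) (x b : ℝ) (c : ℝ → ℝ) (p : (Fin 3 → ℝ) × ℝ) : ℝ :=
  if b ≤ p.2 ∧ ∀ j ≠ i, p.1 j < 1 / 2 then
    if ∀ j ≠ i, p.2 < initialBid (p.1 j) ∨ c p.2 < laterBid p.2 (p.1 j) then 0 else x - c p.2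
  else if ∀ j ≠ i, b < initialBid (p.1 j) then 0 else x - b

lemma measurable_payoff (i : Fin 3) (x b : ℝ) {c : ℝ → ℝ} (hc : Measurable c) :
    Measurable (payoff i x b c) := by
  have hinit : ∀ j, Measurable fun p : (Fin 3 → ℝ) × ℝ => initialBid (p.1 j) := fun j =>
    measurable_initialBid.comp (by fun_prop)
  have hlater : ∀ j, Measurable fun p : (Fin 3 → ℝ) × ℝ => laterBid p.2 (p.1 j) := fun j =>
    measurable_snd.laterBid (by fun_prop)
  have hc' : Measurable fun p : (Fin 3 → ℝ) × ℝ => c p.2 := hc.comp measurable_snd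
  refine Measurable.ite ?_ (Measurable.ite ?_ measurable_const (hc'.const_sub x))
    (Measurable.ite ?_ measurable_const measurable_const)
  · refine (measurableSet_le measurable_const measurable_snd).inter ?_
    exact measurableSet_forall_ne i fun j => measurableSet_lt (by fun_prop) measurable_const
  · exact measurableSet_forall_ne i fun j =>
      (measurableSet_lt measurable_snd (hinit j)).union (measurableSet_lt hc' (hlater j))
  · exact measurableSet_forall_ne i fun j => measurableSet_lt measurable_const (hinit j)

/-- Ties with an agent's initial bid have probability zero. -/
lemma ae_initialBid_ne (b : ℝ) : ∀ᵐ v ∂valuesLaw, ∀ j, initialBid (v j) ≠ b := by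
  refine ae_values_of_ae (P := fun x => initialBid x ≠ b) (ae_not_of_subsingleton ?_)
  rintro x ⟨hx, hx'⟩ y ⟨hy, hy'⟩
  exact strictMonoOn_initialBid.injOn hx' hy' (hx.trans hy.symm)

/-- Ties after a message at time `t` have probability zero. -/
lemma ae_laterBid_ne {t : ℝ} (ht : t ∈ Set.Icc (0 : ℝ) (2 / 9)) (c : ℝ) :
    ∀ᵐ v ∂valuesLaw, ∀ j, t < initialBid (v j) ∨ laterBid t (v j) ≠ c := by
  have : ∀ᵐ x ∂valueLaw, ¬ (¬ t < initialBid x ∧ laterBid t x = c) := by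
    refine ae_not_of_subsingleton ?_
    rintro x ⟨hx, hx'⟩ y ⟨hy, hy'⟩
    have hw := outsideType_mem t
    have hx1 : x ≤ outsideType t :=
      not_lt.1 fun h => hx.1 ((lt_initialBid_iff hx'.1 hx'.2 ht).2 h)
    have hy1 : y ≤ outsideType t :=
      not_lt.1 fun h => hy.1 ((lt_initialBid_iff hy'.1 hy'.2 ht).2 h)
    have hxy := hx.2.trans hy.2.symm
    rw [laterBid, laterBid, min_eq_left hx1, min_eq_left hy1] at hxy
    exact strictMonoOn_bYN.injOn ⟨hx'.1, hx1.trans hw.2⟩ ⟨hy'.1, hy1.trans hw.2⟩ hxy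
  refine ae_values_of_ae (P := fun x => t < initialBid x ∨ laterBid t x ≠ c) ?_
  filter_upwards [this] with x hx
  tauto

/-- Outside a null set the seed is interior, values lie in [0, 1] and nobody ties with i. Then the
message reaches i exactly when both opponents are below 1/2 and the bid of i is at most the seed. -/
lemma ae_payoff_eq {T₀ : ℝ} (hT₀ : 1 ≤ T₀) (i : Fin 3) {d : Strategy Unit} (x : ℝ)
    (hd : Measurable fun t => d [((), t)] t x) :
    (fun ω : (Fin 3 → ℝ) × ℝ =>
      utility (contBadNewsGame T₀) (deviation i d) (Function.update ω.1 i x) ω.2 i)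
      =ᵐ[valuesLaw.prod seedLaw] payoff i x (d [] T₀ x) (fun t => d [((), t)] t x) := by
  have h1 : ∀ᵐ ω ∂valuesLaw.prod seedLaw, ω.2 ∈ Set.Ioo (0 : ℝ) (2 / 9) :=
    Measure.quasiMeasurePreserving_snd.ae ae_seed_mem
  have h2 : ∀ᵐ ω ∂valuesLaw.prod seedLaw, ∀ j, ω.1 j ∈ Set.Icc (0 : ℝ) 1 :=
    Measure.quasiMeasurePreserving_fst.ae ae_values_mem
  have h3 : ∀ᵐ ω ∂valuesLaw.prod seedLaw, ∀ j, initialBid (ω.1 j) ≠ d [] T₀ x :=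
    Measure.quasiMeasurePreserving_fst.ae (ae_initialBid_ne _)
  have h4 : ∀ᵐ ω ∂valuesLaw.prod seedLaw, ∀ j, ω.2 < initialBid (ω.1 j) ∨
      laterBid ω.2 (ω.1 j) ≠ d [((), ω.2)] ω.2 x := by
    refine ae_prior_of_ae ?_ ?_
    · simp only [Set.ofPred_forall]
      refine MeasurableSet.iInter fun j => MeasurableSet.union ?_ (MeasurableSet.compl ?_)
      · exact measurableSet_lt measurable_snd (measurable_initialBid.comp (by fun_prop))
      · exact measurableSet_eq_fun (measurable_snd.laterBid (by fun_prop))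
          (hd.comp measurable_snd)
    · filter_upwards [ae_seed_mem] with θ hθ
      exact ae_laterBid_ne ⟨hθ.1.le, hθ.2.le⟩ _
  filter_upwards [h1, h2, h3, h4] with ω h1 h2 h3 h4
  unfold payoff
  split_ifs with hc hw hw
  · rw [utility_of_message hT₀ h1.1 h1.2.le
      (fun j hj => (initialBid_lt_iff (h2 j).1 (h2 j).2).2 (hc.2 j hj)) hc.1 fun j _ => h4 j]
    exact if_pos hw
  · rw [utility_of_message hT₀ h1.1 h1.2.le
      (fun j hj => (initialBid_lt_iff (h2 j).1 (h2 j).2).2 (hc.2 j hj)) hc.1 fun j _ => h4 j]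
    exact if_neg hw
  all_goals
    have hN : 0 < ω.2 → ω.2 ≤ 2 / 9 →
        (∀ j ≠ i, initialBid (ω.1 j) < 2 / 9 ∨ initialBid (ω.1 j) ≤ ω.2) → ω.2 < d [] T₀ x := by
      intro _ _ h
      by_contra hlt
      refine hc ⟨not_lt.1 hlt, fun j hj => (initialBid_lt_iff (h2 j).1 (h2 j).2).1 ?_⟩
      rcases h j hj with h | h
      · exact h
      · exact h.trans_lt h1.2
    rw [utility_of_no_message hT₀ hN fun j _ => h3 j]
  · exact if_pos hw
  · exact if_neg hw

/-! ### Expected payoffs at a fixed seed, and the best response to a message -/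

/-- The values that get ahead of an agent who bids `c` after a message at time `t`. -/
def aheadSet (t c : ℝ) : Set ℝ := {v | t < initialBid v ∨ c < laterBid t v}

lemma measurableSet_aheadSet (t c : ℝ) : MeasurableSet (aheadSet t c) :=
  (measurableSet_lt measurable_const measurable_initialBid).union
    (measurableSet_lt measurable_const (measurable_const.laterBid measurable_id))

/-- The values that get ahead of an agent who bids `b` initially. -/
def earlierSet (b : ℝ) : Set ℝ := {v | b < initialBid v}

lemma measurableSet_earlierSet (b : ℝ) : MeasurableSet (earlierSet b) :=
  measurableSet_lt measurable_const measurable_initialBid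

/-- The expected payoff given a seed at which the agent has attempted before. -/
lemma integral_payoff_of_lt (i : Fin 3) (x : ℝ) {b θ : ℝ} (c : ℝ → ℝ) (h : θ < b) :
    ∫ v, payoff i x b c (v, θ) ∂valuesLaw = (x - b) * (1 - valueLaw.real (earlierSet b) ^ 2) := by
  have e : (fun v => payoff i x b c (v, θ)) =
      fun v => (x - b) - (opponentsIn i (earlierSet b)).indicator (fun _ => x - b) v := by
    funext v
    have h1 : ¬ (b ≤ θ ∧ ∀ j ≠ i, v j < 1 / 2) := fun h' => absurd h'.1 (not_le.2 h)
    by_cases h2 : v ∈ opponentsIn i (earlierSet b)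
    · have h3 : ∀ j ≠ i, b < initialBid (v j) := h2
      rw [Set.indicator_of_mem h2, payoff, if_neg h1, if_pos h3, sub_self]
    · have h3 : ¬ ∀ j ≠ i, b < initialBid (v j) := h2
      rw [Set.indicator_of_notMem h2, payoff, if_neg h1, if_neg h3, sub_zero]
  have hm := measurableSet_opponentsIn i (measurableSet_earlierSet b)
  rw [e, integral_sub (integrable_const _) ((integrable_const _).indicator hm),
    integral_indicator_const _ hm, valuesLaw_real_opponentsIn]
  simp
  ring

/-- The expected payoff given a seed at which the agent is still outside. -/
lemma integral_payoff_of_le (i : Fin 3) (x : ℝ) {b θ : ℝ} (c : ℝ → ℝ) (h : b ≤ θ) :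
    ∫ v, payoff i x b c (v, θ) ∂valuesLaw =
      (x - c θ) * (1 / 4 - valueLaw.real (aheadSet θ (c θ) ∩ Set.Iio (1 / 2)) ^ 2) +
      (x - b) * (1 - valueLaw.real (earlierSet b) ^ 2 - 1 / 4 +
        valueLaw.real (earlierSet b ∩ Set.Iio (1 / 2)) ^ 2) := by
  classical
  set A := opponentsIn i (aheadSet θ (c θ) ∩ Set.Iio (1 / 2)) with hA
  set B := opponentsIn i (earlierSet b) with hB
  set C := opponentsIn i (earlierSet b ∩ Set.Iio (1 / 2)) with hC
  set N := lowOpponents i with hN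
  have hAm : MeasurableSet A :=
    measurableSet_opponentsIn i ((measurableSet_aheadSet _ _).inter measurableSet_Iio)
  have hBm : MeasurableSet B := measurableSet_opponentsIn i (measurableSet_earlierSet b)
  have hCm : MeasurableSet C :=
    measurableSet_opponentsIn i ((measurableSet_earlierSet _).inter measurableSet_Iio)
  have hNm : MeasurableSet N := measurableSet_opponentsIn i measurableSet_Iio
  -- Inclusion–exclusion. On N the message arrives and i wins except on A. Off N the initial bid
  -- stands and wins off B, and the indicator of the complement of N ∪ B is 1 - B - N + C, since C =
  -- B ∩ N.
  have e : (fun v => payoff i x b c (v, θ)) = fun v =>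
      (N.indicator (fun _ => x - c θ) v - A.indicator (fun _ => x - c θ) v) +
      ((((x - b) - B.indicator (fun _ => x - b) v) - N.indicator (fun _ => x - b) v) +
        C.indicator (fun _ => x - b) v) := by
    funext v
    have hAv : v ∈ A ↔ v ∈ N ∧ ∀ j ≠ i, θ < initialBid (v j) ∨ c θ < laterBid θ (v j) :=
      ⟨fun h => ⟨fun j hj => (h j hj).2, fun j hj => (h j hj).1⟩,
        fun h j hj => ⟨h.2 j hj, h.1 j hj⟩⟩
    have hCv : v ∈ C ↔ v ∈ N ∧ v ∈ B :=
      ⟨fun h => ⟨fun j hj => (h j hj).2, fun j hj => (h j hj).1⟩,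
        fun h j hj => ⟨h.2 j hj, h.1 j hj⟩⟩
    have hBv : v ∈ B ↔ ∀ j ≠ i, b < initialBid (v j) := Iff.rfl
    have hNv : (b ≤ θ ∧ ∀ j ≠ i, v j < 1 / 2) ↔ v ∈ N := by
      simp only [h, true_and]; exact Iff.rfl
    have hA' : A.indicator (fun _ => x - c θ) v = if v ∈ N ∧ ∀ j ≠ i,
        θ < initialBid (v j) ∨ c θ < laterBid θ (v j) then x - c θ else 0 := by
      simp only [Set.indicator_apply, hAv]
    have hC' : C.indicator (fun _ => x - b) v = if v ∈ N ∧ v ∈ B then x - b else 0 := by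
      simp only [Set.indicator_apply, hCv]
    rw [hA', hC', Set.indicator_apply, Set.indicator_apply, Set.indicator_apply]
    simp only [payoff, hNv, ← hBv]
    by_cases h1 : v ∈ N
    · by_cases h2 : v ∈ B <;>
        by_cases h3 : ∀ j ≠ i, θ < initialBid (v j) ∨ c θ < laterBid θ (v j) <;>
        rw [if_pos h1, if_pos h1] <;> simp only [h1, h2, true_and] <;>
        first | rw [if_pos h3, if_pos h3] | rw [if_neg h3, if_neg h3]
      all_goals simp
    · by_cases h2 : v ∈ B <;> simp [h1, h2]
  have hi : ∀ (S : Set (Fin 3 → ℝ)) (_ : MeasurableSet S) (r : ℝ),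
      Integrable (S.indicator fun _ => r) valuesLaw := fun S hS r =>
    (integrable_const r).indicator hS
  have hNA : Integrable (fun v => N.indicator (fun _ => x - c θ) v -
      A.indicator (fun _ => x - c θ) v) valuesLaw := (hi N hNm _).sub (hi A hAm _)
  have hB1 : Integrable (fun v => (x - b) - B.indicator (fun _ => x - b) v) valuesLaw :=
    (integrable_const _).sub (hi B hBm _)
  have hB2 : Integrable (fun v => (x - b) - B.indicator (fun _ => x - b) v -
      N.indicator (fun _ => x - b) v) valuesLaw := hB1.sub (hi N hNm _)
  have hB3 : Integrable (fun v => (x - b) - B.indicator (fun _ => x - b) v -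
      N.indicator (fun _ => x - b) v + C.indicator (fun _ => x - b) v) valuesLaw :=
    hB2.add (hi C hCm _)
  rw [e, integral_add hNA hB3, integral_sub (hi N hNm _) (hi A hAm _),
    integral_add hB2 (hi C hCm _), integral_sub hB1 (hi N hNm _),
    integral_sub (integrable_const _) (hi B hBm _),
    integral_indicator_const _ hNm, integral_indicator_const _ hAm, integral_indicator_const _ hBm,
    integral_indicator_const _ hCm, integral_indicator_const _ hNm, valuesLaw_real_lowOpponents,
    valuesLaw_real_opponentsIn, valuesLaw_real_opponentsIn, valuesLaw_real_opponentsIn]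
  simp
  ring

/-- Types above `outsideType t` entered before the message, and those between z and `outsideType t`
outbid `bYN z` after it. Together they are the types above z, so the truncation in `laterBid` does
not affect the ranking. -/
lemma mem_aheadSet_bYN {t z v : ℝ} (ht : t ∈ Set.Icc (0 : ℝ) (2 / 9))
    (hz : z ∈ Set.Icc 0 (outsideType t)) (hv : v ∈ Set.Icc (0 : ℝ) 1) :
    v ∈ aheadSet t (bYN z) ↔ z < v := by
  have hw := outsideType_mem t
  have h1 : bYN z < laterBid t v ↔ z < min v (outsideType t) :=
    strictMonoOn_bYN.lt_iff_lt ⟨hz.1, hz.2.trans hw.2⟩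
      ⟨le_min hv.1 hw.1, (min_le_right _ _).trans hw.2⟩
  change (t < initialBid v ∨ bYN z < laterBid t v) ↔ z < v
  rw [lt_initialBid_iff hv.1 hv.2 ht, h1, lt_min_iff]
  constructor
  · rintro (h | h)
    · exact hz.2.trans_lt h
    · exact h.1
  · intro h
    rcases lt_or_ge (outsideType t) v with h' | h'
    · exact Or.inl h'
    · exact Or.inr ⟨h, h.trans_le h'⟩

lemma valueLaw_real_aheadSet_bYN {t z : ℝ} (ht : t ∈ Set.Icc (0 : ℝ) (2 / 9))
    (hz : z ∈ Set.Icc 0 (outsideType t)) :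
    valueLaw.real (aheadSet t (bYN z) ∩ Set.Iio (1 / 2)) = 1 / 2 - z :=
  valueLaw_real_lt hz.1 (hz.2.trans (outsideType_mem t).2) (by norm_num) fun v hv => by
    rw [Set.mem_inter_iff, mem_aheadSet_bYN ht hz hv, Set.mem_Iio]

/-- The bid after a message is optimal. -/
lemma gain_after_message_le {t c x : ℝ} (ht : t ∈ Set.Icc (0 : ℝ) (2 / 9)) (hc : 0 ≤ c) :
    (x - c) * (1 / 4 - valueLaw.real (aheadSet t c ∩ Set.Iio (1 / 2)) ^ 2) ≤ messageGain x t := by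
  have hw := outsideType_mem t
  -- Any response c is replaced by a type's response `bYN z` that costs no more and wins equally
  -- often. A bid of at least `bYN (outsideType t)` is overtaken by nobody still outside, so z =
  -- `outsideType t` serves; a smaller bid is some `bYN z` by the intermediate value theorem.
  obtain ⟨z, hz, hzc, hm⟩ : ∃ z ∈ Set.Icc 0 (outsideType t), bYN z ≤ c ∧
      valueLaw.real (aheadSet t c ∩ Set.Iio (1 / 2)) = 1 / 2 - z := by
    rcases le_total (bYN (outsideType t)) c with h | h
    · refine ⟨outsideType t, ⟨hw.1, le_rfl⟩, h, ?_⟩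
      refine valueLaw_real_lt hw.1 hw.2 (by norm_num) fun v hv => and_congr_left fun _ => ?_
      rw [← lt_initialBid_iff hv.1 hv.2 ht]
      refine or_iff_left (not_lt.2 (le_trans ?_ h))
      exact strictMonoOn_bYN.monotoneOn ⟨le_min hv.1 hw.1, (min_le_right _ _).trans hw.2⟩ hw
        (min_le_right _ _)
    · have := intermediate_value_Icc hw.1
        (continuousOn_bYN.mono (Set.Icc_subset_Icc_right hw.2))
      rw [bYN_zero] at this
      obtain ⟨z, hz, rfl⟩ := this ⟨hc, h⟩
      exact ⟨z, hz, le_rfl, valueLaw_real_aheadSet_bYN ht hz⟩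
  have hz1 : z ≤ 1 / 2 := hz.2.trans hw.2
  have h1 : 0 ≤ z - z ^ 2 := by nlinarith [hz.1]
  calc _ = (z - z ^ 2) * (x - c) := by rw [hm]; ring
    _ ≤ (z - z ^ 2) * (x - bYN z) := mul_le_mul_of_nonneg_left (by linarith) h1
    _ = postGain z x := postGain_eq x hz1
    _ ≤ messageGain x t := postGain_le hz.2 hw.2

lemma gain_after_message_eq {t x : ℝ} (ht : t ∈ Set.Icc (0 : ℝ) (2 / 9)) (hx : 0 ≤ x) :
    (x - laterBid t x) *
      (1 / 4 - valueLaw.real (aheadSet t (laterBid t x) ∩ Set.Iio (1 / 2)) ^ 2) =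
        messageGain x t := by
  have hw := outsideType_mem t
  rw [messageGain, ← postGain_eq x ((min_le_right _ _).trans hw.2), laterBid,
    valueLaw_real_aheadSet_bYN ht ⟨le_min hx hw.1, min_le_right _ _⟩]
  ring

/-! ### Expected payoffs at the start -/

lemma valueLaw_real_earlierSet {b : ℝ} (hb : b ∈ Set.Icc (0 : ℝ) (2 / 9)) :
    valueLaw.real (earlierSet b) = 1 - outsideType b := by
  have hw := outsideType_mem b
  refine valueLaw_real hw.1 (hw.2.trans (by norm_num)) le_rfl fun v hv => ?_
  rw [← lt_initialBid_iff hv.1 hv.2 hb]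
  exact ⟨fun h => ⟨h, hv.2⟩, fun h => h.1⟩

lemma valueLaw_real_earlierSet_low {b : ℝ} (hb : b ∈ Set.Icc (0 : ℝ) (2 / 9)) :
    valueLaw.real (earlierSet b ∩ Set.Iio (1 / 2)) = 1 / 2 - outsideType b := by
  have hw := outsideType_mem b
  refine valueLaw_real_lt hw.1 hw.2 (by norm_num) fun v hv => ?_
  rw [← lt_initialBid_iff hv.1 hv.2 hb]
  exact Iff.rfl

lemma valueLaw_real_earlierSet_initialBid {y : ℝ} (hy : y ∈ Set.Icc (0 : ℝ) 1) :
    valueLaw.real (earlierSet (initialBid y)) = 1 - y := by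
  refine valueLaw_real hy.1 hy.2 le_rfl fun v hv => ?_
  rw [← strictMonoOn_initialBid.lt_iff_lt hy hv]
  exact ⟨fun h => ⟨h, hv.2⟩, fun h => h.1⟩

/-- The expected payoff from bids by time `2 / 9`. -/
lemma early_payoff_le (x : ℝ) {b : ℝ} (hb : 2 / 9 ≤ b) :
    ∃ y ∈ Set.Icc (1 / 2 : ℝ) 1,
      (x - b) * (1 - valueLaw.real (earlierSet b) ^ 2) ≤ earlyGain x y := by
  rcases le_or_gt b (1 / 3) with h | h
  · have := intermediate_value_Icc (by norm_num : (1 / 2 : ℝ) ≤ 1)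
      (continuousOn_bI.mono (Set.Icc_subset_Icc_left (by norm_num)))
    rw [bI_half, bI_one] at this
    obtain ⟨y, hy, rfl⟩ := this ⟨hb, h⟩
    refine ⟨y, hy, ?_⟩
    rw [← initialBid_of_le hy.1, valueLaw_real_earlierSet_initialBid ⟨by linarith [hy.1], hy.2⟩,
      initialBid_of_le hy.1, earlyGain_eq x hy.2]
  -- No type bids above `bI 1` = 1/3, so a bid b > 1/3 wins for sure and is dominated by imitating
  -- type 1.
  · refine ⟨1, ⟨by norm_num, le_rfl⟩, ?_⟩
    have : valueLaw.real (earlierSet b) = 1 - 1 := by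
      refine valueLaw_real zero_le_one le_rfl le_rfl fun v hv => ?_
      have := (initialBid_mem hv.1 hv.2).2
      refine ⟨fun h' => ?_, fun h' => absurd h'.1 (not_lt.2 h'.2)⟩
      have h'' : b < initialBid v := h'
      linarith
    rw [this, earlyGain]
    linarith

lemma integrable_payoff (i : Fin 3) {x b : ℝ} {c : ℝ → ℝ} (hx : x ∈ Set.Icc (0 : ℝ) 1)
    (hcm : Measurable c) (hc : ∀ t, 0 < t → c t ∈ Set.Icc 0 t) :
    Integrable (payoff i x b c) (valuesLaw.prod seedLaw) := by
  refine Integrable.of_bound (measurable_payoff i x b hcm).aestronglyMeasurable (1 + |x - b|) ?_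
  have h1 : ∀ᵐ ω ∂valuesLaw.prod seedLaw, ω.2 ∈ Set.Ioo (0 : ℝ) (2 / 9) :=
    Measure.quasiMeasurePreserving_snd.ae ae_seed_mem
  filter_upwards [h1] with ω hω
  have hcω := hc ω.2 hω.1
  have h2 : |x - c ω.2| ≤ 1 := by
    rw [abs_le]; constructor <;> linarith [hcω.1, hcω.2, hx.1, hx.2, hω.2]
  have h3 := abs_nonneg (x - b)
  rw [payoff, Real.norm_eq_abs]
  split_ifs
  · rw [abs_zero]; linarith
  · linarith
  · rw [abs_zero]; linarith
  · linarith

lemma integral_payoff_early (i : Fin 3) (x : ℝ) {b : ℝ} (c : ℝ → ℝ) (hb : 2 / 9 ≤ b) :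
    ∫ θ, ∫ v, payoff i x b c (v, θ) ∂valuesLaw ∂seedLaw =
      (x - b) * (1 - valueLaw.real (earlierSet b) ^ 2) := by
  have : ∀ᵐ θ ∂seedLaw, ∫ v, payoff i x b c (v, θ) ∂valuesLaw =
      (x - b) * (1 - valueLaw.real (earlierSet b) ^ 2) := by
    filter_upwards [ae_seed_mem] with θ hθ
    exact integral_payoff_of_lt i x c (hθ.2.trans_le hb)
  rw [integral_congr_ae this, integral_const]
  simp

open Classical in
/-- The expected payoff given the seed, from the initial bid `b` and optimal bids later. -/
def bestGain (x b θ : ℝ) : ℝ :=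
  if θ < b then (x - b) * (1 - (1 - outsideType b) ^ 2)
  else messageGain x θ + (x - b) * outsideType b

lemma integrable_bestGain {x : ℝ} (hx : x ∈ Set.Icc (0 : ℝ) 1) (b : ℝ) :
    Integrable (bestGain x b) seedLaw := by
  have hm : Measurable (bestGain x b) :=
    Measurable.ite measurableSet_Iio measurable_const
      ((measurable_messageGain x).add measurable_const)
  refine Integrable.of_bound hm.aestronglyMeasurable
    (|(x - b) * (1 - (1 - outsideType b) ^ 2)| + (1 + |(x - b) * outsideType b|))
    (Filter.Eventually.of_forall fun θ => ?_)
  rw [bestGain, Real.norm_eq_abs]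
  have h1 := abs_nonneg ((x - b) * (1 - (1 - outsideType b) ^ 2))
  have h2 := abs_nonneg ((x - b) * outsideType b)
  split_ifs
  · linarith
  · have := abs_add_le (messageGain x θ) ((x - b) * outsideType b)
    linarith [abs_messageGain_le hx θ]

lemma integral_bestGain {x b : ℝ} (hx : x ∈ Set.Icc (0 : ℝ) 1)
    (hb : b ∈ Set.Ico (0 : ℝ) (2 / 9)) :
    ∫ θ, bestGain x b θ ∂seedLaw = waitGain x (outsideType b) := by
  have hbN := bNN_outsideType ⟨hb.1, hb.2.le⟩
  have e1 : Set.EqOn (bestGain x b) (fun _ => (x - b) * (1 - (1 - outsideType b) ^ 2))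
      (Set.Ioo 0 b) := fun θ hθ => if_pos hθ.2
  have e2 : Set.EqOn (bestGain x b) (fun θ => messageGain x θ + (x - b) * outsideType b)
      (Set.Ioo b (2 / 9)) := fun θ hθ => if_neg (not_lt.2 hθ.1.le)
  have hi1 : IntervalIntegrable (bestGain x b) volume 0 b := by
    refine (intervalIntegrable_const (c := (x - b) * (1 - (1 - outsideType b) ^ 2))).congr_uIoo ?_
    rw [Set.uIoo_of_le hb.1]
    exact e1.symm
  have hi2 : IntervalIntegrable (bestGain x b) volume b (2 / 9) := by
    refine ((intervalIntegrable_messageGain hx b (2 / 9)).add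
      (intervalIntegrable_const (c := (x - b) * outsideType b))).congr_uIoo ?_
    rw [Set.uIoo_of_le hb.2.le]
    exact e2.symm
  -- With y = `outsideType b`, the seeds below b contribute the winning probability 2y - y² and
  -- those above b contribute y. The weights 9b/2 and 1 - 9b/2 combine these to y + (9/2)b(y - y²),
  -- the factor in `waitGain`.
  rw [integral_seedLaw, ← intervalIntegral.integral_add_adjacent_intervals hi1 hi2,
    intervalIntegral.integral_congr_Ioo_of_le hb.1 e1,
    intervalIntegral.integral_congr_Ioo_of_le hb.2.le e2,
    intervalIntegral.integral_add (intervalIntegrable_messageGain hx _ _) intervalIntegrable_const,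
    intervalIntegral.integral_const, intervalIntegral.integral_const, waitGain, hbN]
  simp only [smul_eq_mul]
  ring

lemma integral_payoff_wait_eq (i : Fin 3) (x : ℝ) {b θ : ℝ} (c : ℝ → ℝ)
    (hb : b ∈ Set.Ico (0 : ℝ) (2 / 9)) :
    ∫ v, payoff i x b c (v, θ) ∂valuesLaw =
      if θ < b then (x - b) * (1 - (1 - outsideType b) ^ 2)
      else (x - c θ) * (1 / 4 - valueLaw.real (aheadSet θ (c θ) ∩ Set.Iio (1 / 2)) ^ 2) +
        (x - b) * outsideType b := by
  have hb' : b ∈ Set.Icc (0 : ℝ) (2 / 9) := ⟨hb.1, hb.2.le⟩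
  split_ifs with h
  · rw [integral_payoff_of_lt i x c h, valueLaw_real_earlierSet hb']
  -- For y = `outsideType b`, the probability of winning at b while some opponent is above 1/2 is 1
  -- - (1-y)² - 1/4 + (1/2-y)² = y.
  · rw [integral_payoff_of_le i x c (not_lt.1 h), valueLaw_real_earlierSet hb',
      valueLaw_real_earlierSet_low hb']
    ring

lemma integral_payoff_wait_le (i : Fin 3) {x b : ℝ} {c : ℝ → ℝ} (hx : x ∈ Set.Icc (0 : ℝ) 1)
    (hb : b ∈ Set.Ico (0 : ℝ) (2 / 9)) (hcm : Measurable c) (hc : ∀ t, 0 < t → c t ∈ Set.Icc 0 t) :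
    ∫ θ, ∫ v, payoff i x b c (v, θ) ∂valuesLaw ∂seedLaw ≤ waitGain x (outsideType b) := by
  rw [← integral_bestGain hx hb]
  refine integral_mono_ae (integrable_payoff i hx hcm hc).integral_prod_right
    (integrable_bestGain hx b) ?_
  filter_upwards [ae_seed_mem] with θ hθ
  have := gain_after_message_le (x := x) ⟨hθ.1.le, hθ.2.le⟩ (hc θ hθ.1).1
  simp only [integral_payoff_wait_eq i x c hb, bestGain]
  split_ifs
  · exact le_rfl
  · linarith

lemma integral_payoff_wait (i : Fin 3) {x b : ℝ} (hx : x ∈ Set.Icc (0 : ℝ) 1)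
    (hb : b ∈ Set.Ico (0 : ℝ) (2 / 9)) :
    ∫ θ, ∫ v, payoff i x b (fun t => laterBid t x) (v, θ) ∂valuesLaw ∂seedLaw =
      waitGain x (outsideType b) := by
  rw [← integral_bestGain hx hb]
  refine integral_congr_ae ?_
  filter_upwards [ae_seed_mem] with θ hθ
  have := gain_after_message_eq (t := θ) ⟨hθ.1.le, hθ.2.le⟩ hx.1
  simp only [integral_payoff_wait_eq i x _ hb, bestGain, this]

/-- The initial bid is optimal. -/
lemma integral_payoff_le_eqStrategy (i : Fin 3) {x b : ℝ} {c : ℝ → ℝ}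
    (hx : x ∈ Set.Icc (0 : ℝ) 1) (hb : 0 ≤ b) (hcm : Measurable c)
    (hc : ∀ t, 0 < t → c t ∈ Set.Icc 0 t) :
    ∫ θ, ∫ v, payoff i x b c (v, θ) ∂valuesLaw ∂seedLaw ≤
      ∫ θ, ∫ v, payoff i x (initialBid x) (fun t => laterBid t x) (v, θ) ∂valuesLaw ∂seedLaw := by
  rcases lt_or_ge x (1 / 2) with hx2 | hx2
  · have hx' : x ∈ Set.Icc (0 : ℝ) (1 / 2) := ⟨hx.1, hx2.le⟩
    rw [integral_payoff_wait i hx ⟨(initialBid_mem hx.1 hx.2).1, initialBid_lt hx.1 hx2⟩,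
      initialBid_of_lt hx2, outsideType_bNN hx']
    rcases lt_or_ge b (2 / 9) with hb2 | hb2
    · refine (integral_payoff_wait_le i hx ⟨hb, hb2⟩ hcm hc).trans ?_
      have := waitGain_le hx (outsideType_mem b)
      rwa [min_eq_left hx2.le] at this
    · rw [integral_payoff_early i x c hb2]
      obtain ⟨y, hy, hle⟩ := early_payoff_le x hb2
      exact hle.trans (earlyGain_le_waitGain hx' hy.1 hy.2)
  · rw [integral_payoff_early i x _ (le_initialBid hx2 hx.2),
      valueLaw_real_earlierSet_initialBid hx, initialBid_of_le hx2, earlyGain_eq x hx.2]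
    rcases lt_or_ge b (2 / 9) with hb2 | hb2
    · exact (integral_payoff_wait_le i hx ⟨hb, hb2⟩ hcm hc).trans
        (waitGain_le_earlyGain ⟨hx2, hx.2⟩ (outsideType_mem b))
    · rw [integral_payoff_early i x c hb2]
      obtain ⟨y, hy, hle⟩ := early_payoff_le x hb2
      have := earlyGain_le hx.2 hy.1 hy.2
      rw [max_eq_left hx2] at this
      exact hle.trans this

/-! ### Beliefs -/

/-- The belief of agent `i` after a message at time `t`: the opponents' types are below
`1 / 2`. -/
def messageBelief (i : Fin 3) (t : ℝ) : Measure ((Fin 3 → ℝ) × ℝ) :=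
  (ProbabilityTheory.cond valuesLaw (lowOpponents i)).prod (Measure.dirac t)

lemma measurableSet_lowOpponents (i : Fin 3) : MeasurableSet (lowOpponents i) :=
  measurableSet_opponentsIn i measurableSet_Iio

instance (i : Fin 3) : IsProbabilityMeasure
    (ProbabilityTheory.cond valuesLaw (lowOpponents i)) :=
  cond_isProbabilityMeasure (valuesLaw_lowOpponents_ne_zero i)

instance (i : Fin 3) (t : ℝ) : IsProbabilityMeasure (messageBelief i t) := by
  unfold messageBelief; infer_instance

lemma messageBelief_apply (i : Fin 3) (t : ℝ) {A : Set ((Fin 3 → ℝ) × ℝ)} (hA : MeasurableSet A) :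
    messageBelief i t A =
      ProbabilityTheory.cond valuesLaw (lowOpponents i) ((fun v => (v, t)) ⁻¹' A) := by
  rw [messageBelief, Measure.prod_dirac, Measure.map_apply measurable_prodMk_right hA]

lemma measurable_messageBelief (i : Fin 3) : Measurable (messageBelief i) := by
  refine Measure.measurable_of_measurable_coe _ fun A hA => ?_
  simp_rw [messageBelief_apply i _ hA]
  exact measurable_measure_prodMk_right hA

/-- The belief of agent `i` at a message history. -/
def beliefAt (i : Fin 3) : MsgHistory Unit → Measure ((Fin 3 → ℝ) × ℝ)
  | [(_, t)] => messageBelief i t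
  | _ => valuesLaw.prod seedLaw

lemma measurable_beliefAt (i : Fin 3) : Measurable (beliefAt i) := by
  refine measurable_of_ofFn fun n => ?_
  rcases n with _ | _ | n
  · simp [beliefAt]
  · have : (fun p : Fin 1 → Unit × ℝ => beliefAt i (List.ofFn p)) =
        fun p => messageBelief i (p 0).2 := by
      funext p; simp [beliefAt]
    rw [this]
    exact (measurable_messageBelief i).comp (by fun_prop)
  · have : (fun p : Fin (n + 2) → Unit × ℝ => beliefAt i (List.ofFn p)) =
        fun _ => valuesLaw.prod seedLaw := by
      funext p; simp [beliefAt, List.ofFn_succ]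
    rw [this]
    exact measurable_const

/-- The belief system of the equilibrium. -/
def eqBeliefs : BeliefSystem 3 Unit ℝ := fun i => ⟨beliefAt i, measurable_beliefAt i⟩

lemma eqBeliefs_nil (i : Fin 3) : eqBeliefs i [] = valuesLaw.prod seedLaw := rfl

lemma eqBeliefs_singleton (i : Fin 3) (t : ℝ) : eqBeliefs i [((), t)] = messageBelief i t := rfl

lemma eqBeliefs_prob (i : Fin 3) (h : MsgHistory Unit) : IsProbabilityMeasure (eqBeliefs i h) := by
  rcases h with _ | ⟨⟨u, t⟩, _ | ⟨q, h⟩⟩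
  · change IsProbabilityMeasure (valuesLaw.prod seedLaw); infer_instance
  · change IsProbabilityMeasure (messageBelief i t); infer_instance
  · change IsProbabilityMeasure (valuesLaw.prod seedLaw); infer_instance

section Seen

variable {T₀ : ℝ} {i : Fin 3} {v : Fin 3 → ℝ} {θ : ℝ}

lemma messagesSeenBy_cases (hT₀ : 1 ≤ T₀) (i : Fin 3) (v : Fin 3 → ℝ) (θ : ℝ) :
    messagesSeenBy (contBadNewsGame T₀) (fun _ => eqStrategy) i (v, θ) = [] ∨
      (messagesSeenBy (contBadNewsGame T₀) (fun _ => eqStrategy) i (v, θ) = [((), θ)] ∧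
        0 < θ ∧ θ ≤ 2 / 9 ∧ ∀ j ≠ i, initialBid (v j) < 2 / 9 ∨ initialBid (v j) ≤ θ) := by
  rcases publicMessages_cases (σ := deviation i abstain) (v := v) (θ := θ) hT₀ with h | h
  · exact Or.inl h
  · exact Or.inr ⟨h.1, h.2.1, h.2.2.1, fun j hj => by simpa [hj] using h.2.2.2 j⟩

lemma messagesSeenBy_eq (hT₀ : 1 ≤ T₀) (h0 : 0 < θ) (h1 : θ ≤ 2 / 9)
    (hv : ∀ j ≠ i, initialBid (v j) < 2 / 9) :
    messagesSeenBy (contBadNewsGame T₀) (fun _ => eqStrategy) i (v, θ) = [((), θ)] :=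
  publicMessages_eq (σ := deviation i abstain) (v := v) hT₀ h0 h1 i
    (fun j hj => by simpa [hj] using hv j hj) (by simpa [abstain] using h0.le)

-- Up to null sets, an agent who stays out sees a message exactly when both opponents are below 1/2,
-- and its time is the seed. The values of low opponents are thus independent of the time of the
-- message.
open Classical in
lemma ae_messagesSeenBy (hT₀ : 1 ≤ T₀) (i : Fin 3) :
    ∀ᵐ ω ∂valuesLaw.prod seedLaw,
      messagesSeenBy (contBadNewsGame T₀) (fun _ => eqStrategy) i ω =
        if ω.1 ∈ lowOpponents i then [((), ω.2)] else [] := by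
  have h1 : ∀ᵐ ω ∂valuesLaw.prod seedLaw, ω.2 ∈ Set.Ioo (0 : ℝ) (2 / 9) :=
    Measure.quasiMeasurePreserving_snd.ae ae_seed_mem
  have h2 : ∀ᵐ ω ∂valuesLaw.prod seedLaw, ∀ j, ω.1 j ∈ Set.Icc (0 : ℝ) 1 :=
    Measure.quasiMeasurePreserving_fst.ae ae_values_mem
  filter_upwards [h1, h2] with ω h1 h2
  split_ifs with h
  · exact messagesSeenBy_eq hT₀ h1.1 h1.2.le fun j hj =>
      (initialBid_lt_iff (h2 j).1 (h2 j).2).2 (h j hj)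
  · rcases messagesSeenBy_cases hT₀ i ω.1 ω.2 with h' | ⟨-, -, -, h'⟩
    · exact h'
    · refine (h fun j hj => (initialBid_lt_iff (h2 j).1 (h2 j).2).1 ?_).elim
      exact (h' j hj).elim id fun h' => h'.trans_lt h1.2

lemma ae_messageBelief {P : (Fin 3 → ℝ) × ℝ → Prop} {t : ℝ}
    (h : ∀ᵐ v ∂ProbabilityTheory.cond valuesLaw (lowOpponents i), P (v, t)) :
    ∀ᵐ ω ∂messageBelief i t, P ω := by
  rw [messageBelief, Measure.prod_dirac]
  exact (MeasurableEmbedding.prodMk_right MeasurableEmbedding.id t).ae_map_iff.2 h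

lemma ae_cond_lowOpponents (i : Fin 3) :
    ∀ᵐ v ∂ProbabilityTheory.cond valuesLaw (lowOpponents i),
      v ∈ lowOpponents i ∧ ∀ j, v j ∈ Set.Icc (0 : ℝ) 1 :=
  (ae_cond_mem (measurableSet_lowOpponents i)).and
    (cond_absolutelyContinuous.ae_le ae_values_mem)

lemma eq_nil_or_eq_of_prefix_singleton {α : Type*} {h : List α} {m : α} (hpre : h <+: [m]) :
    h = [] ∨ h = [m] := by
  rcases h with _ | ⟨a, l⟩
  · exact Or.inl rfl
  · exact Or.inr (hpre.eq_of_length_le (by simp))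

lemma beliefsFit_eqBeliefs (hT₀ : 1 ≤ T₀) :
    BeliefsFit (contBadNewsGame T₀) (fun _ => eqStrategy) eqBeliefs := by
  rintro i h ⟨⟨v, θ⟩, -, hpre⟩
  rcases messagesSeenBy_cases hT₀ i v θ with hs | ⟨hs, h0, h1, -⟩
  · rw [hs, List.prefix_nil] at hpre
    subst hpre
    exact Filter.Eventually.of_forall fun _ => List.nil_prefix
  · rw [hs] at hpre
    rcases eq_nil_or_eq_of_prefix_singleton hpre with rfl | rfl
    · exact Filter.Eventually.of_forall fun _ => List.nil_prefix
    rw [eqBeliefs_singleton]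
    refine ae_messageBelief ?_
    filter_upwards [ae_cond_lowOpponents i] with v hv
    rw [messagesSeenBy_eq hT₀ h0 h1 fun j hj =>
      (initialBid_lt_iff (hv.2 j).1 (hv.2 j).2).2 (hv.1 j hj)]

/-- Conditioning on no messages gives the prior, and two messages never occur. The case of one
message is a disintegration of the prior over the seed, restricted to the event that both opponents
are low. -/
lemma bayesConsistent_eqBeliefs (hT₀ : 1 ≤ T₀) :
    BayesConsistent (contBadNewsGame T₀) (fun _ => eqStrategy) eqBeliefs := by
  classical
  intro i j B A hB hA
  rw [prior_eq]
  set ψ := messagesSeenBy (contBadNewsGame T₀) (fun _ => eqStrategy) i with hψ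
  rcases j with _ | _ | j
  · simp only [zero_le, true_and, List.take_zero, eqBeliefs_nil]
    by_cases hnil : ([] : MsgHistory Unit) ∈ B <;> simp [hnil]
  · have hB' : MeasurableSet {θ : ℝ | ([((), θ)] : MsgHistory Unit) ∈ B} :=
      measurable_singleton_history hB
    set B' := {θ : ℝ | ([((), θ)] : MsgHistory Unit) ∈ B} with hB'def
    have hN := measurableSet_lowOpponents i
    have hae := ae_messagesSeenBy hT₀ i
    have hset : {ω | 0 + 1 ≤ (ψ ω).length ∧ (ψ ω).take (0 + 1) ∈ B}
        =ᵐ[valuesLaw.prod seedLaw] lowOpponents i ×ˢ B' := by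
      filter_upwards [hae] with ω hω
      apply propext
      change (0 + 1 ≤ (ψ ω).length ∧ (ψ ω).take (0 + 1) ∈ B) ↔ ω.1 ∈ lowOpponents i ∧ ω.2 ∈ B'
      rw [hψ, hω]
      by_cases h : ω.1 ∈ lowOpponents i
      · rw [if_pos h]; simp [h, hB'def]
      · rw [if_neg h]; simp [h]
    have hfun : ∀ᵐ ω ∂valuesLaw.prod seedLaw, ω ∈ lowOpponents i ×ˢ B' →
        eqBeliefs i ((ψ ω).take (0 + 1)) A = messageBelief i ω.2 A := by
      filter_upwards [hae] with ω hω hmem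
      rw [hψ, hω, if_pos hmem.1, ← eqBeliefs_singleton]
      rfl
    have hg : Measurable fun θ => messageBelief i θ A :=
      (Measure.measurable_coe hA).comp (measurable_messageBelief i)
    rw [setLIntegral_congr hset, setLIntegral_congr_fun_ae (hN.prod hB') hfun,
      measure_congr (hset.inter (Filter.EventuallyEq.refl _ A)),
      Measure.prod_apply_symm ((hN.prod hB').inter hA), ← Measure.prod_restrict,
      lintegral_prod_symm (fun ω : (Fin 3 → ℝ) × ℝ => messageBelief i ω.2 A)
        (hg.comp measurable_snd).aemeasurable, ← lintegral_indicator hB']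
    -- On the fibre over a seed θ, the prior mass of `lowOpponents i` times the conditional law is
    -- the prior restricted to that event.
    refine lintegral_congr fun θ => ?_
    by_cases hθ : θ ∈ B'
    · rw [Set.indicator_of_mem hθ]
      change _ = ∫⁻ _ in lowOpponents i, messageBelief i θ A ∂valuesLaw
      rw [lintegral_const, Measure.restrict_apply_univ,
        messageBelief_apply i θ hA, cond_mul_eq_inter hN]
      congr 1
      ext v
      simp [hθ]
    · rw [Set.indicator_of_notMem hθ]
      have : (fun v : Fin 3 → ℝ => (v, θ)) ⁻¹' (lowOpponents i ×ˢ B' ∩ A) = ∅ := by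
        ext v; simp [hθ]
      rw [this, measure_empty]
  · have : {ω | j + 1 + 1 ≤ (ψ ω).length ∧ (ψ ω).take (j + 1 + 1) ∈ B} = ∅ := by
      ext ω
      simp only [Set.mem_ofPred_eq, Set.mem_empty_iff_false, iff_false, not_and]
      intro hlen
      rcases messagesSeenBy_cases hT₀ i ω.1 ω.2 with h | ⟨h, -⟩ <;>
        · rw [hψ, h] at hlen
          simp at hlen
    rw [this]
    simp

end Seen

/-! ### Optimality -/

section Optimality

variable {T₀ : ℝ} {i : Fin 3} {d : Strategy Unit} {x : ℝ}

lemma stayOutUntil_nil (d : Strategy Unit) : stayOutUntil [] d = d := by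
  funext h t x
  exact if_pos List.nil_prefix

lemma Feasible.measurable_response (hd : Feasible (contBadNewsGame T₀) d) (x : ℝ) :
    Measurable fun t => d [((), t)] t x :=
  hd.1.comp (measurable_singleton_history.prodMk (measurable_id.prodMk measurable_const))

lemma Feasible.response_mem (hd : Feasible (contBadNewsGame T₀) d) (hx : x ∈ Set.Icc (0 : ℝ) 1)
    (t : ℝ) (ht : 0 < t) : d [((), t)] t x ∈ Set.Icc 0 t :=
  hd.2.2 [] () t ht x hx

lemma continuationValue_nil (hT₀ : 1 ≤ T₀) (hx : x ∈ Set.Icc (0 : ℝ) 1)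
    (hd : Feasible (contBadNewsGame T₀) d) :
    continuationValue (contBadNewsGame T₀) (fun _ => eqStrategy) eqBeliefs i [] x d =
      ∫ θ, ∫ v, payoff i x (d [] T₀ x) (fun t => d [((), t)] t x) (v, θ) ∂valuesLaw ∂seedLaw := by
  rw [continuationValue, eqBeliefs_nil, stayOutUntil_nil,
    integral_congr_ae (ae_payoff_eq hT₀ i x (hd.measurable_response x))]
  exact integral_prod_symm _
    (integrable_payoff i hx (hd.measurable_response x) (hd.response_mem hx))

lemma stayOutUntil_singleton_nil (t u x : ℝ) (d : Strategy Unit) :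
    stayOutUntil [((), t)] d [] u x = 0 :=
  if_neg (by simp)

lemma stayOutUntil_self (h : MsgHistory Unit) (t x : ℝ) (d : Strategy Unit) :
    stayOutUntil h d h t x = d h t x :=
  if_pos (List.prefix_refl h)

-- The prescribed continuation bids 0 at the start, so i is certainly outside at time t. The factor
-- 4 is the inverse of the probability that both opponents are low.
open Classical in
lemma continuationValue_singleton (hT₀ : 1 ≤ T₀) {t : ℝ} (ht : t ∈ Set.Ioc (0 : ℝ) (2 / 9)) :
    continuationValue (contBadNewsGame T₀) (fun _ => eqStrategy) eqBeliefs i [((), t)] x d =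
      4 * ((x - d [((), t)] t x) *
        (1 / 4 - valueLaw.real (aheadSet t (d [((), t)] t x) ∩ Set.Iio (1 / 2)) ^ 2)) := by
  set c := d [((), t)] t x with hc
  set N := lowOpponents i with hN
  set A := opponentsIn i (aheadSet t c ∩ Set.Iio (1 / 2)) with hA
  have hNm : MeasurableSet N := measurableSet_lowOpponents i
  have hAm : MeasurableSet A :=
    measurableSet_opponentsIn i ((measurableSet_aheadSet _ _).inter measurableSet_Iio)
  have hAN : A ⊆ N := fun v hv j hj => (hv j hj).2
  have hae : ∀ᵐ v ∂ProbabilityTheory.cond valuesLaw N,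
      utility (contBadNewsGame T₀) (deviation i (stayOutUntil [((), t)] d))
        (Function.update v i x) t i = (x - c) - A.indicator (fun _ => x - c) v := by
    filter_upwards [ae_cond_lowOpponents i,
      cond_absolutelyContinuous.ae_le (ae_laterBid_ne ⟨ht.1.le, ht.2⟩ c)] with v hv hne
    rw [utility_of_message hT₀ ht.1 ht.2
      (fun j hj => (initialBid_lt_iff (hv.2 j).1 (hv.2 j).2).2 (hv.1 j hj))
      (by rw [stayOutUntil_singleton_nil]; exact ht.1.le)
      (fun j _ => by rw [stayOutUntil_self]; exact hne j), stayOutUntil_self]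
    by_cases h : v ∈ A
    · rw [Set.indicator_of_mem h, sub_self]
      exact if_pos fun j hj => (h j hj).1
    · rw [Set.indicator_of_notMem h, sub_zero]
      exact if_neg fun h' => h fun j hj => ⟨h' j hj, hv.1 j hj⟩
  have hmap : ∀ f : (Fin 3 → ℝ) × ℝ → ℝ, ∫ ω, f ω ∂messageBelief i t =
      ∫ v, f (v, t) ∂ProbabilityTheory.cond valuesLaw N := by
    intro f
    rw [messageBelief, Measure.prod_dirac]
    exact (MeasurableEmbedding.prodMk_right MeasurableEmbedding.id t).integral_map f
  have hreal : (ProbabilityTheory.cond valuesLaw N).real A =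
      4 * valueLaw.real (aheadSet t c ∩ Set.Iio (1 / 2)) ^ 2 := by
    rw [Measure.real, cond_apply hNm, Set.inter_eq_self_of_subset_right hAN, ENNReal.toReal_mul,
      ENNReal.toReal_inv, ← Measure.real, ← Measure.real, valuesLaw_real_lowOpponents,
      valuesLaw_real_opponentsIn]
    norm_num
  rw [continuationValue, eqBeliefs_singleton, hmap, integral_congr_ae hae,
    integral_sub (integrable_const _) ((integrable_const _).indicator hAm),
    integral_indicator_const _ hAm, hreal, integral_const]
  simp
  ring

/-- At a history that cannot occur the strategies make no difference. -/
lemma continuationValue_of_impossible (hT₀ : 1 ≤ T₀) {h : MsgHistory Unit} (hnil : h ≠ [])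
    (hsing : ∀ u, 0 < u → u ≤ 2 / 9 → h ≠ [((), u)]) (d' : Strategy Unit) :
    continuationValue (contBadNewsGame T₀) (fun _ => eqStrategy) eqBeliefs i h x d =
      continuationValue (contBadNewsGame T₀) (fun _ => eqStrategy) eqBeliefs i h x d' := by
  -- The histories that occur in a play are the empty one and single messages at times in (0, 2/9].
  -- None of them extends h, so both continuations bid 0 throughout.
  have hout : ∀ (e : Strategy Unit) (h' : MsgHistory Unit) (t y : ℝ),
      (h' = [] ∨ ∃ u, 0 < u ∧ u ≤ 2 / 9 ∧ h' = [((), u)]) → stayOutUntil h e h' t y = 0 := by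
    intro e h' t y hh'
    refine if_neg fun hpre => ?_
    rcases hh' with rfl | ⟨u, h0, h1, rfl⟩
    · exact hnil (List.prefix_nil.1 hpre)
    · exact (eq_nil_or_eq_of_prefix_singleton hpre).elim hnil (hsing u h0 h1)
  have hagree : ∀ j h' t y, (h' = [] ∨ ∃ u, 0 < u ∧ u ≤ 2 / 9 ∧ h' = [((), u)]) →
      deviation i (stayOutUntil h d) j h' t y = deviation i (stayOutUntil h d') j h' t y := by
    intro j h' t y hh'
    by_cases hj : j = i
    · subst hj
      simp only [Function.update_self]
      rw [hout d h' t y hh', hout d' h' t y hh']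
    · simp [hj]
  have hu : ∀ (v : Fin 3 → ℝ) (θ : ℝ),
      utility (contBadNewsGame T₀) (deviation i (stayOutUntil h d)) v θ i =
        utility (contBadNewsGame T₀) (deviation i (stayOutUntil h d')) v θ i := by
    intro v θ
    rw [utility, utility, play_congr hT₀ hagree]
  simp only [continuationValue, hu]

lemma optimal_eqStrategy (hT₀ : 1 ≤ T₀) (i : Fin 3) (h : MsgHistory Unit)
    (hx : x ∈ Set.Icc (0 : ℝ) 1) (hd : Feasible (contBadNewsGame T₀) d) :
    continuationValue (contBadNewsGame T₀) (fun _ => eqStrategy) eqBeliefs i h x d ≤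
      continuationValue (contBadNewsGame T₀) (fun _ => eqStrategy) eqBeliefs i h x eqStrategy := by
  by_cases hnil : h = []
  · subst hnil
    rw [continuationValue_nil hT₀ hx hd, continuationValue_nil hT₀ hx (feasible_eqStrategy hT₀)]
    simp only [eqStrategy_nil, eqStrategy_singleton]
    exact integral_payoff_le_eqStrategy i hx (hd.2.1 x hx).1 (hd.measurable_response x)
      (hd.response_mem hx)
  · by_cases hsing : ∃ u, 0 < u ∧ u ≤ 2 / 9 ∧ h = [((), u)]
    · obtain ⟨t, h0, h1, rfl⟩ := hsing
      rw [continuationValue_singleton hT₀ ⟨h0, h1⟩, continuationValue_singleton hT₀ ⟨h0, h1⟩,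
        eqStrategy_singleton, gain_after_message_eq ⟨h0.le, h1⟩ hx.1]
      exact mul_le_mul_of_nonneg_left
        (gain_after_message_le ⟨h0.le, h1⟩ (hd.response_mem hx t h0).1) (by norm_num)
    · exact (continuationValue_of_impossible hT₀ hnil
        (fun u h0 h1 hu => hsing ⟨u, h0, h1, hu⟩) eqStrategy).le

lemma isPBE_eqStrategy (hT₀ : 1 ≤ T₀) :
    IsPBE (contBadNewsGame T₀) (fun _ => eqStrategy) eqBeliefs where
  feasible _ := feasible_eqStrategy hT₀
  prob := eqBeliefs_prob
  bayes := bayesConsistent_eqBeliefs hT₀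
  fit := beliefsFit_eqBeliefs hT₀
  optimal i h _ hx _ hd := optimal_eqStrategy hT₀ i h hx hd

end Optimality

/-! ### Efficiency -/

/-- Each coincidence v j = v i confines the vector to a proper linear subspace, which is Lebesgue
null, and the law of the values is a restriction of Lebesgue measure. -/
lemma ae_values_ne : ∀ᵐ v ∂valuesLaw, ∀ i j : Fin 3, j ≠ i → v j ≠ v i := by
  have hac : valuesLaw ≪ (volume : Measure (Fin 3 → ℝ)) := by
    have : valuesLaw = (Measure.pi fun _ : Fin 3 => (volume : Measure ℝ)).restrict
        (Set.univ.pi fun _ => Set.Icc 0 1) := by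
      rw [Measure.restrict_pi_pi, valuesLaw, valueLaw_eq]
    rw [this]
    exact Measure.restrict_le_self.absolutelyContinuous
  suffices h : ∀ᵐ v ∂(volume : Measure (Fin 3 → ℝ)), ∀ i j : Fin 3, j ≠ i → v j ≠ v i from
    hac.ae_le h
  simp only [ae_all_iff]
  intro i j hij
  let f : (Fin 3 → ℝ) →ₗ[ℝ] ℝ := LinearMap.proj (R := ℝ) (φ := fun _ => ℝ) j - LinearMap.proj i
  have htop : LinearMap.ker f ≠ ⊤ := by
    intro h
    have : Pi.single j (1 : ℝ) ∈ LinearMap.ker f := by rw [h]; trivial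
    rw [LinearMap.mem_ker] at this
    simp [f, hij.symm] at this
  have h0 := Measure.addHaar_submodule (volume : Measure (Fin 3 → ℝ)) _ htop
  rw [ae_iff]
  refine measure_mono_null (fun v hv => ?_) h0
  have hv' : v j = v i := not_not.1 hv
  change f v = 0
  simp [f, hv']

lemma laterBid_le_laterBid (t : ℝ) {u v : ℝ} (hu : 0 ≤ u) (huv : u ≤ v) :
    laterBid t u ≤ laterBid t v := by
  have hw := outsideType_mem t
  exact strictMonoOn_bYN.monotoneOn ⟨le_min hu hw.1, (min_le_right _ _).trans hw.2⟩
    ⟨le_min (hu.trans huv) hw.1, (min_le_right _ _).trans hw.2⟩ (min_le_min_right _ huv)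

/-- With distinct values, an agent among the top two has a strictly lower opponent l. Initial and
later bids are monotone in the value, so l never gets ahead, and with two places an agent loses only
if both opponents are ahead. -/
lemma assortativelyEfficient_eqStrategy {T₀ : ℝ} (hT₀ : 1 ≤ T₀) :
    AssortativelyEfficient (contBadNewsGame T₀) (fun _ => eqStrategy) := by
  classical
  rw [AssortativelyEfficient, prior_eq]
  have h1 : ∀ᵐ ω ∂valuesLaw.prod seedLaw, ω.2 ∈ Set.Ioo (0 : ℝ) (2 / 9) :=
    Measure.quasiMeasurePreserving_snd.ae ae_seed_mem
  have h2 : ∀ᵐ ω ∂valuesLaw.prod seedLaw, ∀ j, ω.1 j ∈ Set.Icc (0 : ℝ) 1 :=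
    Measure.quasiMeasurePreserving_fst.ae ae_values_mem
  have h3 : ∀ᵐ ω ∂valuesLaw.prod seedLaw, ∀ i j : Fin 3, j ≠ i → ω.1 j ≠ ω.1 i :=
    Measure.quasiMeasurePreserving_fst.ae ae_values_ne
  filter_upwards [h1, h2, h3] with ⟨v, θ⟩ h1 h2 h3
  intro i hcard
  simp only at h1 h2 h3
  obtain ⟨l, hl, hlv⟩ : ∃ l ≠ i, v l < v i := by
    by_contra! hall
    have hsub : ({i}ᶜ : Finset (Fin 3)) ⊆ Finset.univ.filter fun j => v i < v j := by
      intro j hj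
      have hj' : j ≠ i := by simpa using hj
      simpa using lt_of_le_of_ne (hall j hj') (h3 i j hj').symm
    have hle := Finset.card_le_card hsub
    have hc : ({i}ᶜ : Finset (Fin 3)).card = 2 := by simp [Finset.card_compl]
    have hlt : (Finset.univ.filter fun j => v i < v j).card < 2 := by
      have hk : (contBadNewsGame T₀).k = 2 := rfl
      rw [hk] at hcard
      convert hcard
    omega
  have hbid : ∀ j ≠ i, initialBid (v j) ≠ initialBid (v i) := fun j hj h =>
    h3 i j hj (strictMonoOn_initialBid.injOn (h2 j) (h2 i) h)
  have hlb : initialBid (v l) < initialBid (v i) := strictMonoOn_initialBid (h2 l) (h2 i) hlv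
  -- The two cases are whether the message reaches i before the initial bid of i comes due.
  by_cases hM : initialBid (v i) ≤ θ ∧ ∀ j ≠ i, v j < 1 / 2
  · have hst := play_status_of_message (σ := fun _ => eqStrategy) (v := v) hT₀ i h1.1 h1.2.le
      (fun j hj => by simpa using (initialBid_lt_iff (h2 j).1 (h2 j).2).2 (hM.2 j hj))
      (by simpa using hM.1) (fun j hj => by
        simp only [eqStrategy_nil, eqStrategy_singleton]
        by_contra! hcon
        have hθ : θ ∈ Set.Icc (0 : ℝ) (2 / 9) := ⟨h1.1.le, h1.2.le⟩
        have hw := outsideType_mem θ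
        have hj1 : v j ≤ outsideType θ := not_lt.1 fun h =>
          absurd ((lt_initialBid_iff (h2 j).1 (h2 j).2 hθ).2 h) (not_lt.2 hcon.1)
        have hi1 : v i ≤ outsideType θ := not_lt.1 fun h =>
          absurd ((lt_initialBid_iff (h2 i).1 (h2 i).2 hθ).2 h) (not_lt.2 hM.1)
        have heq := hcon.2
        rw [laterBid, laterBid, min_eq_left hj1, min_eq_left hi1] at heq
        exact h3 i j hj (strictMonoOn_bYN.injOn ⟨(h2 j).1, hj1.trans hw.2⟩
          ⟨(h2 i).1, hi1.trans hw.2⟩ heq))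
    rw [if_neg] at hst
    · exact ⟨_, hst⟩
    intro hall
    have := hall l hl
    simp only [eqStrategy_nil, eqStrategy_singleton] at this
    rcases this with h | h
    · exact absurd h (not_lt.2 (hlb.le.trans hM.1))
    · exact absurd h (not_lt.2 (laterBid_le_laterBid θ (h2 l).1 hlv.le))
  · have hst := play_status_of_no_message (σ := fun _ => eqStrategy) (v := v) (θ := θ) hT₀ i
      (fun _ _ hj => by
        simp only [eqStrategy_nil] at hj ⊢
        by_contra hlt
        refine hM ⟨not_lt.1 hlt, fun j hj' => (initialBid_lt_iff (h2 j).1 (h2 j).2).1 ?_⟩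
        exact (hj j hj').elim id fun h => h.trans_lt h1.2)
      (fun j hj => by simpa using hbid j hj)
    rw [if_neg] at hst
    · exact ⟨_, hst⟩
    intro hall
    have := hall l hl
    simp only [eqStrategy_nil] at this
    exact absurd this (not_lt.2 hlb.le)

lemma valueLaw_Icc_pos {a b : ℝ} (ha : 0 ≤ a) (hab : a < b) (hb : b ≤ 1) :
    0 < valueLaw (Set.Icc a b) := by
  rw [valueLaw_eq, Measure.restrict_apply' measurableSet_Icc,
    Set.inter_eq_self_of_subset_left (Set.Icc_subset_Icc ha hb), Real.volume_Icc]
  simpa using hab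

/-- If all values are at most 1/9, then so are all initial bids, by `bNN_le_self`. Any seed in [1/9,
2/9] then produces the message, and this product set has positive probability. -/
lemma message_pos {T₀ : ℝ} (hT₀ : 1 ≤ T₀) :
    0 < prior (contBadNewsGame T₀)
      {ω | publicMessages (contBadNewsGame T₀) (fun _ => eqStrategy) ω.1 ω.2 ≠ []} := by
  have hsub : (Set.univ.pi fun _ : Fin 3 => Set.Icc (0 : ℝ) (1 / 9)) ×ˢ Set.Icc (1 / 9 : ℝ) (2 / 9) ⊆
      {ω | publicMessages (contBadNewsGame T₀) (fun _ => eqStrategy) ω.1 ω.2 ≠ []} := by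
    rintro ⟨v, θ⟩ ⟨hv, hθ⟩
    have hb : ∀ j, initialBid (v j) ≤ 1 / 9 := by
      intro j
      have hj := hv j (Set.mem_univ j)
      rw [initialBid_of_lt (hj.2.trans_lt (by norm_num))]
      exact (bNN_le_self hj.1 (hj.2.trans (by norm_num))).trans hj.2
    have := publicMessages_eq (σ := fun _ => eqStrategy) (v := v) (θ := θ) hT₀
      (lt_of_lt_of_le (by norm_num) hθ.1) hθ.2 0
      (fun j _ => by rw [eqStrategy_nil]; exact (hb j).trans_lt (by norm_num))
      (by rw [eqStrategy_nil]; exact (hb 0).trans hθ.1)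
    change publicMessages (contBadNewsGame T₀) (fun _ => eqStrategy) v θ ≠ []
    rw [this]
    simp
  refine lt_of_lt_of_le ?_ (measure_mono hsub)
  rw [prior_eq, Measure.prod_prod, Measure.pi_pi]
  refine ENNReal.mul_pos ?_ ?_
  · exact Finset.prod_ne_zero_iff.2 fun _ _ =>
      (valueLaw_Icc_pos le_rfl (by norm_num) (by norm_num)).ne'
  · have : seedLaw (Set.Icc (1 / 9) (2 / 9)) =
        (9 / 2 : ℝ).toNNReal • volume (Set.Icc (1 / 9 : ℝ) (2 / 9)) := by
      rw [seedLaw_eq, Measure.smul_apply, Measure.restrict_apply' measurableSet_Icc,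
        Set.inter_eq_self_of_subset_left (Set.Icc_subset_Icc (by norm_num) le_rfl)]
    rw [this, Real.volume_Icc, ENNReal.smul_def]
    refine (ENNReal.mul_pos ?_ ?_).ne'
    · norm_num
    · norm_num

end Queueing

end

theorem mainTheorem7 (T₀ : ℝ) (hT₀ : 1 ≤ T₀) :
    ∃ (s : Queueing.Strategy Unit) (β : Queueing.BeliefSystem 3 Unit ℝ),
      -- the initial sealed bid: `bI` for types entering by time `2/9`, `bNN` for the others
      (∀ v ∈ Set.Icc (1 / 2 : ℝ) 1, s [] T₀ v = Queueing.bI v) ∧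
      (∀ v ∈ Set.Ico (0 : ℝ) (1 / 2), s [] T₀ v = Queueing.bNN v) ∧
      -- after a message at time `t`, when `w` is the highest type that should still be outside
      (∀ t ∈ Set.Ioc (0 : ℝ) (2 / 9), ∀ w ∈ Set.Icc (0 : ℝ) (1 / 2), Queueing.bNN w = t →
        ∀ v ∈ Set.Icc (0 : ℝ) 1, s [((), t)] t v = Queueing.bYN (min v w)) ∧
      Queueing.IsPBE (Queueing.contBadNewsGame T₀) (fun _ => s) β ∧
      Queueing.AssortativelyEfficient (Queueing.contBadNewsGame T₀) (fun _ => s) ∧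
      -- the policy has bite: a message is sent with positive probability
      0 < Queueing.prior (Queueing.contBadNewsGame T₀)
        {ω | Queueing.publicMessages (Queueing.contBadNewsGame T₀) (fun _ => s) ω.1 ω.2 ≠ []} := by
  refine ⟨Queueing.eqStrategy, Queueing.eqBeliefs, fun v hv => ?_, fun v hv => ?_,
    fun t _ w hw hwt v _ => ?_, Queueing.isPBE_eqStrategy hT₀,
    Queueing.assortativelyEfficient_eqStrategy hT₀, Queueing.message_pos hT₀⟩
  · rw [Queueing.eqStrategy_nil, Queueing.initialBid_of_le hv.1]
  · rw [Queueing.eqStrategy_nil, Queueing.initialBid_of_lt hv.2]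
  · rw [Queueing.eqStrategy_singleton, Queueing.laterBid, ← hwt, Queueing.outsideType_bNN hw]
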